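/- Let $M$ be a smooth manifold (finite-dimensional, Hausdorff, second countable) with tangent bundle $T$, and let $H\in\Omega^3(M)$ be a three-form (in the Courant algebroid setting $H$ is closed; this is not needed here). On $T\oplus T^*$ let $\pi(X+\alpha)=X$, $\langle X+\alpha,Y+\beta\rangle=\alpha(Y)+\beta(X)$ and $[X+\alpha,Y+\beta]_H=[X,Y]+\mathcal L_X\beta-\imath_Y\mathrm d\alpha+\imath_Y\imath_XH$. Let $\mathcal G$ be a (possibly indefinite) generalized metric: an endomorphism of $T\oplus T^*$ with $\mathcal G^2=1$ and $\langle\mathcal G\cdot,\mathcal G\cdot\rangle=\langle\cdot,\cdot\rangle$ such that $\pi$ restricts to isomorphisms $\pi_\pm:C_\pm\to T$ on its $\pm1$-eigenbundles. Then $\pi_\pm^{-1}X=X+(b\pm g)X$ for a pseudo-Riemannian metric $g$ and a two-form $b$; put $H_b=H+\mathrm db$. With $u_\pm=\tfrac12(1\pm\mathcal G)u$ and $C(X+\alpha)=X+2b(X)-\alpha$, the generalized Bismut connection of $\mathcal G$ is $$D_uv=[u_-,v_+]_{H+}+[u_+,v_-]_{H-}+[Cu_-,v_-]_{H-}+[Cu_+,v_+]_{H+},$$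 where the last subscript $\pm$ is the projection to $C_\pm$. An endomorphism $\mathcal A$ of $T\oplus T^*$ commuting with $\mathcal G$ is weakly integrable if $D\mathcal A=0$, i.e. $D_u(\mathcal Av)=\mathcal A(D_uv)$ for all sections $u,v$. Put $A_\pm=\pi_\pm\mathcal A\pi_\pm^{-1}\in\mathrm{End}(T)$, $\omega_\pm(X,Y)=g(A_\pm X,Y)$ and $$N_{A_\pm}(X,Y,Z)=g\big([A_\pm X,A_\pm Y]+A_\pm^2[X,Y]-A_\pm([A_\pm X,Y]+[X,A_\pm Y]),\,Z\big).$$ (1) Let $(\mathcal G,\mathcal I)$ be an almost generalized K\"ahler structure, i.e. $\mathcal I$ commutes with $\mathcal G$, $\mathcal I^2=-1$ and $\langle\mathcal I\cdot,\mathcal I\cdot\rangle=\langle\cdot,\cdot\rangle$; let $I_\pm$ be the induced almost complex structures and $(p,q)_\pm$ the type of (complexified) tensors with respect to $I_\pm$. Then $\mathcal I$ is weakly integrable if and only if, for both signs, $$i\big(\mathrm d\omega_\pm^{(3,0)_\pm}-\mathrm d\omega_\pm^{(0,3)_\pm}\big)=\pm3H_b^{(3,0)_\pm+(0,3)_\pm}=\tfrac34N_{I_\pm},\qquad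 \mathrm d\omega_\pm^{(2,1)_\pm+(1,2)_\pm}=\mp i\big(H_b^{(2,1)_\pm}-H_b^{(1,2)_\pm}\big).$$ (2) Let $(\mathcal G,\mathcal K)$ be an almost generalized para-K\"ahler structure, i.e. $\mathcal K$ commutes with $\mathcal G$, $\mathcal K^2=1$ and $\langle\mathcal K\cdot,\mathcal K\cdot\rangle=-\langle\cdot,\cdot\rangle$; let $K_\pm$ be the induced almost para-complex structures and $(p,q)_\pm$ the type with respect to $K_\pm$, where $T^{(1,0)_\pm}$ and $T^{(0,1)_\pm}$ are the $+1$- and $-1$-eigenbundles of $K_\pm$. Then $\mathcal K$ is weakly integrable if and only if, for both signs, $$\mathrm d\omega_\pm^{(3,0)_\pm}=\mp3H_b^{(3,0)_\pm}=\tfrac34N_{K_\pm}^{(3,0)_\pm},\qquad \mathrm d\omega_\pm^{(0,3)_\pm}=\pm3H_b^{(0,3)_\pm}=-\tfrac34N_{K_\pm}^{(0,3)_\pm},$$ $$\mathrm d\omega_\pm^{(2,1)_\pm}=\mp H_b^{(2,1)_\pm},\qquad \mathrm d\omega_\pm^{(1,2)_\pm}=\pm H_b^{(1,2)_\pm}.$$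 -/

import Mathlib

open scoped Manifold ContDiff

noncomputable section

namespace GenGeom

section

variable (E : Type*) [NormedAddCommGroup E] [NormedSpace ℝ E]
  (M : Type*) [TopologicalSpace M] [ChartedSpace E M]

/-- The ring `C^∞(M)` of smooth real functions on `M`. -/
abbrev Fn := C^∞⟮𝓘(ℝ, E), M; 𝓘(ℝ, ℝ), ℝ⟯

variable [IsManifold 𝓘(ℝ, E) ∞ M]

/-- The smooth vector fields on `M`, i.e. the smooth sections of the tangent bundle. -/
abbrev Vec := Cₛ^∞⟮𝓘(ℝ, E); E, (TangentSpace 𝓘(ℝ, E) : M → Type _)⟯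

end

section

variable {E : Type*} [NormedAddCommGroup E] [NormedSpace ℝ E]
  {M : Type*} [TopologicalSpace M] [ChartedSpace E M] [IsManifold 𝓘(ℝ, E) ∞ M]

/-- Vector fields form a module over `C^∞(M)`, by pointwise multiplication. -/
instance instSMulVec : SMul (Fn E M) (Vec E M) where
  smul f X := ⟨fun x => f x • X x, ContMDiff.smul_section f.contMDiff X.contMDiff⟩

theorem smul_vec_apply (f : Fn E M) (X : Vec E M) (x : M) : (f • X) x = f x • X x := rfl

instance instModuleVec : Module (Fn E M) (Vec E M) where
  one_smul X := by ext x; exact one_smul ℝ (X x)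
  mul_smul f g X := by ext x; exact mul_smul (f x) (g x) (X x)
  smul_zero f := by ext x; exact smul_zero (f x)
  smul_add f X Y := by ext x; exact smul_add (f x) (X x) (Y x)
  add_smul f g X := by ext x; exact add_smul (f x) (g x) (X x)
  zero_smul X := by ext x; exact zero_smul ℝ (X x)

/-- The derivative `X f = df(X)` of a smooth function along a vector field. -/
def der (X : Vec E M) (f : Fn E M) : Fn E M :=
  ⟨fun x => d% f x (X x), by
    have h1 : ContMDiff 𝓘(ℝ, E) 𝓘(ℝ, ℝ).tangent ∞
        (fun x => tangentMap 𝓘(ℝ, E) 𝓘(ℝ, ℝ) f (X x : TangentBundle 𝓘(ℝ, E) M)) :=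
      (ContMDiff.contMDiff_tangentMap f.contMDiff (m := ∞) (by simp)).comp X.contMDiff
    exact (contMDiff_snd_tangentBundle_modelSpace ℝ 𝓘(ℝ, ℝ)).comp h1⟩

theorem der_add (X : Vec E M) (f g : Fn E M) : der X (f + g) = der X f + der X g := by
  ext x
  exact congrArg (fun φ => φ (X x)) (mvfderiv_add f.mdifferentiableAt g.mdifferentiableAt)

theorem der_mul (X : Vec E M) (f g : Fn E M) : der X (f * g) = f * der X g + g * der X f := by
  ext x
  exact congrArg (fun φ => φ (X x)) (mvfderiv_mul f.mdifferentiableAt g.mdifferentiableAt)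

theorem der_vec_add (X Y : Vec E M) (f : Fn E M) : der (X + Y) f = der X f + der Y f := by
  ext x
  exact map_add (d% f x) (X x) (Y x)

theorem der_vec_smul (h : Fn E M) (X : Vec E M) (f : Fn E M) : der (h • X) f = h * der X f := by
  ext x
  exact map_smul (d% f x) (h x) (X x)

theorem two_le_infty : (2 : WithTop ℕ∞) ≤ ∞ :=
  WithTop.coe_le_coe.2 le_top

variable [FiniteDimensional ℝ E]

/-- The Lie bracket `[X, Y]` of vector fields. -/
def bracket (X Y : Vec E M) : Vec E M :=
  ⟨VectorField.mlieBracket 𝓘(ℝ, E) X Y, by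
    have : CompleteSpace E := FiniteDimensional.complete ℝ E
    have h1 : IsManifold 𝓘(ℝ, E) (((⊤ : ℕ∞) : WithTop ℕ∞) + 1) M :=
      inferInstanceAs (IsManifold 𝓘(ℝ, E) ∞ M)
    have h2 : IsManifold 𝓘(ℝ, E) (minSmoothness ℝ 2) M :=
      IsManifold.of_le (n := ∞) (by simpa using two_le_infty)
    exact ContDiff.mlieBracket_vectorField (n := ⊤) (m := ⊤) X.contMDiff Y.contMDiff (by simp)⟩

theorem bracket_swap (X Y : Vec E M) : bracket X Y = -bracket Y X := by
  ext x
  exact VectorField.mlieBracket_swap_apply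

theorem bracket_add_right (X Y Z : Vec E M) :
    bracket X (Y + Z) = bracket X Y + bracket X Z := by
  have : CompleteSpace E := FiniteDimensional.complete ℝ E
  have : IsManifold 𝓘(ℝ, E) (minSmoothness ℝ 2) M := IsManifold.of_le (n := ∞) (by simpa using two_le_infty)
  ext x
  exact VectorField.mlieBracket_add_right Y.mdifferentiableAt Z.mdifferentiableAt

theorem bracket_smul_right (X : Vec E M) (f : Fn E M) (Y : Vec E M) :
    bracket X (f • Y) = der X f • Y + f • bracket X Y := by
  have : CompleteSpace E := FiniteDimensional.complete ℝ E
  have : IsManifold 𝓘(ℝ, E) (minSmoothness ℝ 2) M := IsManifold.of_le (n := ∞) (by simpa using two_le_infty)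
  ext x
  exact VectorField.mlieBracket_smul_right (V := X) f.mdifferentiableAt Y.mdifferentiableAt

end

section

variable (E : Type*) [NormedAddCommGroup E] [NormedSpace ℝ E]
  (M : Type*) [TopologicalSpace M] [ChartedSpace E M] [IsManifold 𝓘(ℝ, E) ∞ M]

/-- One-forms, i.e. sections of `T^*`, as `C^∞(M)`-linear functionals on vector fields. -/
abbrev Form1 := Vec E M →ₗ[Fn E M] Fn E M

/-- Three-forms, as alternating `C^∞(M)`-trilinear functions on vector fields. -/
abbrev Form3 := Vec E M [⋀^Fin 3]→ₗ[Fn E M] Fn E M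

/-- Sections `X + α` of the generalized tangent bundle `T ⊕ T^*`. -/
abbrev Sec := Vec E M × Form1 E M

/-- Endomorphisms of the vector bundle `T ⊕ T^*`, as `C^∞(M)`-linear maps of sections. -/
abbrev EndSec := Sec E M →ₗ[Fn E M] Sec E M

end

section

variable {E : Type*} [NormedAddCommGroup E] [NormedSpace ℝ E] [FiniteDimensional ℝ E]
  {M : Type*} [TopologicalSpace M] [ChartedSpace E M] [IsManifold 𝓘(ℝ, E) ∞ M]

/-- The Lie derivative of a one-form, `(L_X β)(Z) = X (β(Z)) - β([X, Z])`. -/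
def lieDer (X : Vec E M) (β : Form1 E M) : Form1 E M where
  toFun Z := der X (β Z) - β (bracket X Z)
  map_add' Y Z := by
    rw [map_add, der_add, bracket_add_right, map_add]; ring
  map_smul' f Z := by
    rw [map_smul, smul_eq_mul, der_mul, bracket_smul_right, map_add, map_smul, map_smul]
    simp only [smul_eq_mul, RingHom.id_apply]; ring

/-- The contraction `ι_Y dα`, where `dα(Y, Z) = Y (α(Z)) - Z (α(Y)) - α([Y, Z])`. -/
def contrD (Y : Vec E M) (α : Form1 E M) : Form1 E M where
  toFun Z := der Y (α Z) - der Z (α Y) - α (bracket Y Z)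
  map_add' Z W := by
    rw [map_add, der_add, der_vec_add, bracket_add_right, map_add]; ring
  map_smul' f Z := by
    rw [map_smul, smul_eq_mul, der_mul, der_vec_smul, bracket_smul_right, map_add, map_smul,
      map_smul]
    simp only [smul_eq_mul, RingHom.id_apply]; ring

/-- The contraction `ι_Y ι_X H = H(X, Y, ·)`. -/
def contrH (H : Form3 E M) (X Y : Vec E M) : Form1 E M where
  toFun Z := H ![X, Y, Z]
  map_add' Z W := by
    have h : ∀ V : Vec E M, (![X, Y, V] : Fin 3 → Vec E M) = Function.update ![X, Y, 0] 2 V := by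
      intro V; ext i; fin_cases i <;> rfl
    rw [h (Z + W), h Z, h W, AlternatingMap.map_update_add]
  map_smul' f Z := by
    have h : ∀ V : Vec E M, (![X, Y, V] : Fin 3 → Vec E M) = Function.update ![X, Y, 0] 2 V := by
      intro V; ext i; fin_cases i <;> rfl
    rw [h (f • Z), h Z, AlternatingMap.map_update_smul]; rfl

/-- The symmetric pairing `⟨X + α, Y + β⟩ = α(Y) + β(X)`. -/
def pairing (u v : Sec E M) : Fn E M := u.2 v.1 + v.2 u.1

/-- The `H`-twisted Dorfman bracket
`[X + α, Y + β]_H = [X, Y] + L_X β - ι_Y dα + ι_Y ι_X H`. -/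
def dorfman (H : Form3 E M) (u v : Sec E M) : Sec E M :=
  (bracket u.1 v.1, lieDer u.1 v.2 - contrD v.1 u.2 + contrH H u.1 v.1)

/-- The exterior derivative of a two-form `β` (given by its values on vector fields). -/
def extD (β : Vec E M → Vec E M → Fn E M) (X Y Z : Vec E M) : Fn E M :=
  der X (β Y Z) - der Y (β X Z) + der Z (β X Y)
    - β (bracket X Y) Z + β (bracket X Z) Y - β (bracket Y Z) X

/-- The Nijenhuis tensor `N_A(X, Y) = [AX, AY] + A²[X, Y] - A([AX, Y] + [X, AY])`
of an endomorphism `A` of the tangent bundle. -/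
def nijenhuis (A : Vec E M → Vec E M) (X Y : Vec E M) : Vec E M :=
  bracket (A X) (A Y) + A (A (bracket X Y)) - A (bracket (A X) Y + bracket X (A Y))

end

section

variable {E : Type*} [NormedAddCommGroup E] [NormedSpace ℝ E]
  {M : Type*} [TopologicalSpace M] [ChartedSpace E M] [IsManifold 𝓘(ℝ, E) ∞ M]

/-- Sections of the eigenbundle of `𝒢` for the eigenvalue `ε = ±1`. -/
def eigenSec (𝒢 : EndSec E M) (ε : ℤˣ) : Submodule (Fn E M) (Sec E M) :=
  LinearMap.ker (𝒢 - ((ε : ℤ) : Fn E M) • LinearMap.id)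

/-- The restriction of the anchor `π : X + α ↦ X` to an eigenbundle of `𝒢`. -/
def anchorOn (𝒢 : EndSec E M) (ε : ℤˣ) : eigenSec 𝒢 ε →ₗ[Fn E M] Vec E M :=
  (LinearMap.fst (Fn E M) (Vec E M) (Form1 E M)).comp (eigenSec 𝒢 ε).subtype

end

section

variable (E : Type*) [NormedAddCommGroup E] [NormedSpace ℝ E] [FiniteDimensional ℝ E]
  (M : Type*) [TopologicalSpace M] [ChartedSpace E M] [IsManifold 𝓘(ℝ, E) ∞ M]

/-- A (possibly indefinite) generalized metric: an endomorphism `𝒢` of `T ⊕ T^*` with `𝒢² = 1`,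
orthogonal for the pairing, whose two eigenbundles `C_±` are isomorphic to `T` via `π`. -/
structure GenMetric where
  /-- the underlying endomorphism `𝒢` -/
  op : EndSec E M
  sq : ∀ u, op (op u) = u
  orth : ∀ u v, pairing (op u) (op v) = pairing u v
  nondeg : ∀ ε : ℤˣ, Function.Bijective (anchorOn op ε)

end

section

variable {E : Type*} [NormedAddCommGroup E] [NormedSpace ℝ E] [FiniteDimensional ℝ E]
  {M : Type*} [TopologicalSpace M] [ChartedSpace E M] [IsManifold 𝓘(ℝ, E) ∞ M]

/-- The inverse `π_ε⁻¹ : T → C_ε` of the isomorphism `π_ε : C_ε → T`, for `ε = ±1`. -/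
def GenMetric.lift (G : GenMetric E M) (ε : ℤˣ) : Vec E M →ₗ[Fn E M] Sec E M :=
  (eigenSec G.op ε).subtype.comp
    (LinearEquiv.ofBijective (anchorOn G.op ε) (G.nondeg ε)).symm.toLinearMap

/-- The pseudo-Riemannian metric `g` of `𝒢 = 𝒢(g, b)`. As `π_±⁻¹ X = X + (b ± g) X`, the one-form
`g X` is half the difference of the cotangent parts of `π_+⁻¹ X` and `π_-⁻¹ X`. -/
def GenMetric.metric (G : GenMetric E M) (X Y : Vec E M) : Fn E M :=
  (1 / 2 : ℝ) • ((G.lift 1 X).2 Y - (G.lift (-1) X).2 Y)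

/-- The two-form `b` of `𝒢 = 𝒢(g, b)`: the one-form `b X = ι_X b` is half the sum of the cotangent
parts of `π_+⁻¹ X` and `π_-⁻¹ X`. -/
def GenMetric.bform (G : GenMetric E M) : Vec E M →ₗ[Fn E M] Form1 E M where
  toFun X := (1 / 2 : ℝ) • ((G.lift 1 X).2 + (G.lift (-1) X).2)
  map_add' X Y := by
    rw [map_add, map_add, Prod.snd_add, Prod.snd_add, ← smul_add]
    congr 1; abel
  map_smul' f X := by
    rw [map_smul, map_smul, Prod.smul_snd, Prod.smul_snd, ← smul_add, smul_comm]; rfl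

/-- The projection `P_ε = (1 + ε 𝒢) / 2` of `T ⊕ T^*` onto `C_ε`. -/
def GenMetric.proj (G : GenMetric E M) (ε : ℤˣ) (u : Sec E M) : Sec E M :=
  (1 / 2 : ℝ) • (u + ε • G.op u)

/-- The endomorphism `C (X + α) = X + 2 b X - α`, which exchanges `C_+` and `C_-`. -/
def GenMetric.swap (G : GenMetric E M) (u : Sec E M) : Sec E M :=
  (u.1, (2 : ℝ) • G.bform u.1 - u.2)

/-- The generalized Bismut connection of `𝒢` for the `H`-twisted Dorfman bracket,
`D_u v = [u_-, v_+]_+ + [u_+, v_-]_- + [C u_-, v_-]_- + [C u_+, v_+]_+`,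
where a subscript `±` denotes the `C_±`-part. -/
def bismut (H : Form3 E M) (G : GenMetric E M) (u v : Sec E M) : Sec E M :=
  G.proj 1 (dorfman H (G.proj (-1) u) (G.proj 1 v))
    + G.proj (-1) (dorfman H (G.proj 1 u) (G.proj (-1) v))
    + G.proj (-1) (dorfman H (G.swap (G.proj (-1) u)) (G.proj (-1) v))
    + G.proj 1 (dorfman H (G.swap (G.proj 1 u)) (G.proj 1 v))

/-- `D 𝒜 = 0` for the generalized Bismut connection `D` of `𝒢`. -/
def WeaklyIntegrable (H : Form3 E M) (G : GenMetric E M) (A : EndSec E M) : Prop :=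
  ∀ u v : Sec E M, bismut H G u (A v) - A (bismut H G u v) = 0

/-- `(𝒢, ℐ)` is an almost generalized Kähler structure: `ℐ` is a generalized almost complex
structure that commutes with the generalized metric `𝒢`. -/
structure IsAlmostGK (G : GenMetric E M) (A : EndSec E M) : Prop where
  sq : ∀ u, A (A u) = -u
  orth : ∀ u v, pairing (A u) (A v) = pairing u v
  comm : ∀ u, G.op (A u) = A (G.op u)

/-- `(𝒢, 𝒦)` is an almost generalized para-Kähler structure: `𝒦` is a generalized almost
para-complex structure that commutes with the generalized metric `𝒢`. -/
structure IsAlmostGpK (G : GenMetric E M) (A : EndSec E M) : Prop where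
  sq : ∀ u, A (A u) = u
  orth : ∀ u v, pairing (A u) (A v) = -pairing u v
  comm : ∀ u, G.op (A u) = A (G.op u)

/-- The endomorphism `A_ε = π_ε 𝒜 π_ε⁻¹` of the tangent bundle induced by `𝒜` on `C_ε`. -/
def tangentEnd (G : GenMetric E M) (A : EndSec E M) (ε : ℤˣ) (X : Vec E M) : Vec E M :=
  (A (G.lift ε X)).1

/-- The fundamental form `ω_ε(X, Y) = g(A_ε X, Y)`. -/
def fundForm (G : GenMetric E M) (A : EndSec E M) (ε : ℤˣ) (X Y : Vec E M) : Fn E M :=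
  G.metric (tangentEnd G A ε X) Y

/-- The flux `H_b = H + db`. -/
def flux (H : Form3 E M) (G : GenMetric E M) (X Y Z : Vec E M) : Fn E M :=
  H ![X, Y, Z] + extD (fun X Y => G.bform X Y) X Y Z

/-- The Nijenhuis tensor of `A_ε` as a covariant tensor, `N(X, Y, Z) = g(N(X, Y), Z)`. -/
def nijTensor (G : GenMetric E M) (A : EndSec E M) (ε : ℤˣ) (X Y Z : Vec E M) : Fn E M :=
  G.metric (nijenhuis (tangentEnd G A ε) X Y) Z

end

section

variable {E : Type*} [NormedAddCommGroup E] [NormedSpace ℝ E]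
  {M : Type*} [TopologicalSpace M] [ChartedSpace E M] [IsManifold 𝓘(ℝ, E) ∞ M]

/-- The projection `(1 + s K) / 2` onto the eigenbundle `T^{(1,0)}` (`s = 1`) or `T^{(0,1)}`
(`s = -1`) of an almost para-complex structure `K`. -/
def paraProj (K : Vec E M → Vec E M) (s : ℤˣ) (X : Vec E M) : Vec E M :=
  (1 / 2 : ℝ) • (X + s • K X)

/-- The component of type `(p, 3 - p)` of a covariant three-tensor with respect to an almost
para-complex structure `K`: the sum of the restrictions of `t` to the triples of eigenbundles of
which exactly `p` are `T^{(1,0)}`. -/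
def paraType (K : Vec E M → Vec E M) (p : ℕ) (t : Vec E M → Vec E M → Vec E M → Fn E M)
    (X Y Z : Vec E M) : Fn E M :=
  ∑ σ : Fin 3 → ℤˣ with (Finset.univ.filter fun i => σ i = 1).card = p,
    t (paraProj K (σ 0) X) (paraProj K (σ 1) Y) (paraProj K (σ 2) Z)

/-- For a `ℂ`-valued one-form `φ` on `T`, extended `ℂ`-linearly to `T ⊗ ℂ`, the one-form
`X ↦ φ ((X - s i I X) / 2)`; here `(1 - s i I) / 2` is the projection of `T ⊗ ℂ` onto the
eigenbundle `T^{(1,0)}` (`s = 1`) or `T^{(0,1)}` (`s = -1`) of an almost complex structure `I`. -/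
def complexProj (I : Vec E M → Vec E M) (s : ℤˣ) (φ : Vec E M → M → ℂ) (X : Vec E M) (x : M) : ℂ :=
  (φ X x - ((s : ℤ) : ℂ) * Complex.I * φ (I X) x) / 2

/-- The `ℂ`-valued component of type `(p, 3 - p)` of a real covariant three-tensor with respect to
an almost complex structure `I`, evaluated on real vector fields. -/
def complexType (I : Vec E M → Vec E M) (p : ℕ) (t : Vec E M → Vec E M → Vec E M → Fn E M)
    (X Y Z : Vec E M) (x : M) : ℂ :=
  ∑ σ : Fin 3 → ℤˣ with (Finset.univ.filter fun i => σ i = 1).card = p,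
    complexProj I (σ 0) (fun X' => complexProj I (σ 1) (fun Y' => complexProj I (σ 2)
      (fun Z' y => ((t X' Y' Z' y : ℝ) : ℂ)) Z) Y) X x

end

end GenGeom

end

open GenGeom

noncomputable section

namespace GenGeom

set_option linter.unusedSectionVars false

/-! ### Real-linear calculus of functions and vector fields. -/

section

variable {E : Type*} [NormedAddCommGroup E] [NormedSpace ℝ E]
  {M : Type*} [TopologicalSpace M] [ChartedSpace E M] [IsManifold 𝓘(ℝ, E) ∞ M]

/-! Both kinds of structure are endomorphisms `A` of `T ⊕ T^*` that commute with `𝒢`, are skew for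
the pairing and satisfy `A² = κ` with `κ = ±1`, so one argument serves for both (`IsSkewStructure`).

The Bismut connection preserves `C_±` and depends on `u` only through its anchor (`bismut_eq`).
Paired with lifts to `C_ε` it is `2 ε g(∇_X Y, Z) + H_b(X, Y, Z)`, with `∇` the Levi-Civita
connection (`pairing_dorfman_lift`). Hence `D A = 0` says, for both signs, that `ε S(X, Y, Z) +
H_b(X, AY, Z) + H_b(X, Y, AZ) = 0`, where `S = 2 ∇ω` and `A` now denotes the endomorphism induced on
`T`.

As `∇` is metric and torsion-free, `S` determines `dω` (cyclic sum, `extD_fundForm`) and the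
Nijenhuis tensor (`nijTensor_eq`). Moreover `S` is skew in its last two arguments and `A` may be
moved between them, so those two arguments must be of equal type. The defect of the parallelism
equation has the same symmetries. It therefore has only a pure part (three equal types) and a mixed
part (first argument of the opposite type). The cyclic sum and the Nijenhuis expression recover the
pure part, and the cyclic sum alone recovers the mixed part (`IsCovFundLike.eq_zero_iff`).
Substituting `dω`, `N` and `H_b` gives three real equations (`parallel_iff`,
`weaklyIntegrable_iff_real`).

Expanding the eigenprojections turns these into the stated type equations. In the complex case each
real equation is one displayed equality. In the para-complex case each splits in two, because the
eigenbundles are real. -/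

instance instScalarTowerVec : IsScalarTower ℝ (Fn E M) (Vec E M) where
  smul_assoc r f X := by ext x; exact smul_assoc r (f x) (X x)

theorem intCast_fn_apply (n : ℤ) (x : M) : ((n : Fn E M) : M → ℝ) x = n :=
  congrFun (map_intCast (ContMDiffMap.coeFnRingHom (I := 𝓘(ℝ, E)) (N := M) (n := ∞)
    (I' := 𝓘(ℝ, ℝ)) (R := ℝ)) n) x

theorem der_algebraMap (X : Vec E M) (r : ℝ) : der X (algebraMap ℝ (Fn E M) r) = 0 := by
  ext x
  exact congrArg (fun φ => φ (X x)) (mvfderiv_const (c := r))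

theorem der_smul (X : Vec E M) (r : ℝ) (f : Fn E M) : der X (r • f) = r • der X f := by
  rw [Algebra.smul_def, der_mul, der_algebraMap, mul_zero, add_zero, Algebra.smul_def]

theorem der_neg (X : Vec E M) (f : Fn E M) : der X (-f) = -der X f := by
  simpa using der_smul X (-1) f

theorem der_sub (X : Vec E M) (f g : Fn E M) : der X (f - g) = der X f - der X g := by
  rw [sub_eq_add_neg, der_add, der_neg, sub_eq_add_neg]

theorem der_vec_real_smul (r : ℝ) (X : Vec E M) (f : Fn E M) : der (r • X) f = r • der X f := by
  rw [← algebraMap_smul (Fn E M) r X, der_vec_smul, Algebra.smul_def]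

/-- A function of three vector fields that is real linear in each of them. -/
structure IsTrilinear (t : Vec E M → Vec E M → Vec E M → Fn E M) : Prop where
  fst : ∀ Y Z, IsLinearMap ℝ fun X => t X Y Z
  snd : ∀ X Z, IsLinearMap ℝ fun Y => t X Y Z
  trd : ∀ X Y, IsLinearMap ℝ fun Z => t X Y Z

/-- A function of two vector fields that is real linear in each of them. -/
structure IsBilinear (t : Vec E M → Vec E M → Fn E M) : Prop where
  fst : ∀ Y, IsLinearMap ℝ fun X => t X Y
  snd : ∀ X, IsLinearMap ℝ fun Y => t X Y

end

/-! ### Lie bracket, exterior derivative, and the pair `(g, b)` of a generalized metric. -/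

section

variable {E : Type*} [NormedAddCommGroup E] [NormedSpace ℝ E] [FiniteDimensional ℝ E]
  {M : Type*} [TopologicalSpace M] [ChartedSpace E M] [IsManifold 𝓘(ℝ, E) ∞ M]

theorem bracket_real_smul_right (r : ℝ) (X Y : Vec E M) :
    bracket X (r • Y) = r • bracket X Y := by
  rw [← algebraMap_smul (Fn E M) r Y, bracket_smul_right, der_algebraMap, zero_smul, zero_add,
    algebraMap_smul]

theorem bracket_add_left (X Y Z : Vec E M) :
    bracket (X + Y) Z = bracket X Z + bracket Y Z := by
  rw [bracket_swap, bracket_add_right, bracket_swap Z X, bracket_swap Z Y]; abel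

theorem bracket_real_smul_left (r : ℝ) (X Y : Vec E M) :
    bracket (r • X) Y = r • bracket X Y := by
  rw [bracket_swap, bracket_real_smul_right, bracket_swap Y X, smul_neg, neg_neg]

theorem isTrilinear_extD {β : Vec E M → Vec E M → Fn E M} (hβ : IsBilinear β) :
    IsTrilinear (extD β) := by
  have l1 := fun Y => (hβ.fst Y).map_add
  have l2 := fun Y => (hβ.fst Y).map_smul
  have r1 := fun X => (hβ.snd X).map_add
  have r2 := fun X => (hβ.snd X).map_smul
  constructor <;> intro _ _ <;> constructor <;> intros <;>
    simp only [extD, l1, l2, r1, r2, der_add, der_smul, der_vec_add, der_vec_real_smul,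
      bracket_add_left, bracket_add_right, bracket_real_smul_left, bracket_real_smul_right,
      smul_sub, smul_add] <;> abel

theorem extD_swap_left {β : Vec E M → Vec E M → Fn E M} (hβ : IsBilinear β)
    (h : ∀ X Y, β X Y = -β Y X) (X Y Z : Vec E M) : extD β X Y Z = -extD β Y X Z := by
  have l1 := fun Y => (hβ.fst Y).map_neg
  simp only [extD]
  rw [h X Y, bracket_swap X Y, l1, der_neg]; ring

theorem extD_swap_right {β : Vec E M → Vec E M → Fn E M} (hβ : IsBilinear β)
    (h : ∀ X Y, β X Y = -β Y X) (X Y Z : Vec E M) : extD β X Y Z = -extD β X Z Y := by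
  have l1 := fun Y => (hβ.fst Y).map_neg
  simp only [extD]
  rw [h Y Z, bracket_swap Y Z, l1, der_neg]; ring

theorem form3_swap_left (H : Form3 E M) (X Y Z : Vec E M) : H ![X, Y, Z] = -H ![Y, X, Z] := by
  have := H.map_swap ![X, Y, Z] (show (0 : Fin 3) ≠ 1 by decide)
  rw [← neg_eq_iff_eq_neg, ← this]
  congr 1; ext i; fin_cases i <;> rfl

theorem form3_swap_right (H : Form3 E M) (X Y Z : Vec E M) : H ![X, Y, Z] = -H ![X, Z, Y] := by
  have := H.map_swap ![X, Y, Z] (show (1 : Fin 3) ≠ 2 by decide)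
  rw [← neg_eq_iff_eq_neg, ← this]
  congr 1; ext i; fin_cases i <;> rfl

theorem isLinearMap_form3_trd (H : Form3 E M) (X Y : Vec E M) :
    IsLinearMap ℝ fun Z => H ![X, Y, Z] :=
  ⟨(contrH H X Y).map_add, (contrH H X Y).map_smul_of_tower⟩

namespace GenMetric

variable (G : GenMetric E M)

theorem lift_fst (ε : ℤˣ) (X : Vec E M) : (G.lift ε X).1 = X :=
  (LinearEquiv.ofBijective (anchorOn G.op ε) (G.nondeg ε)).apply_symm_apply X

theorem mem_eigenSec {ε : ℤˣ} {u : Sec E M} : u ∈ eigenSec G.op ε ↔ G.op u = ε • u := by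
  rw [eigenSec, LinearMap.mem_ker, LinearMap.sub_apply, sub_eq_zero, LinearMap.smul_apply,
    LinearMap.id_apply, Int.cast_smul_eq_zsmul, Units.smul_def]

theorem op_lift (ε : ℤˣ) (X : Vec E M) : G.op (G.lift ε X) = ε • G.lift ε X :=
  G.mem_eigenSec.1 (Subtype.mem _)

theorem eq_lift {ε : ℤˣ} {u : Sec E M} (h : G.op u = ε • u) : u = G.lift ε u.1 := by
  have h1 : (⟨u, G.mem_eigenSec.2 h⟩ : eigenSec G.op ε)
      = (LinearEquiv.ofBijective (anchorOn G.op ε) (G.nondeg ε)).symm u.1 := by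
    rw [LinearEquiv.eq_symm_apply]; rfl
  exact congrArg Subtype.val h1

theorem lift_one_snd (X Y : Vec E M) : (G.lift 1 X).2 Y = G.bform X Y + G.metric X Y := by
  ext x
  simp [bform, metric]; ring

theorem lift_neg_one_snd (X Y : Vec E M) : (G.lift (-1) X).2 Y = G.bform X Y - G.metric X Y := by
  ext x
  simp [bform, metric]; ring

theorem lift_snd (ε : ℤˣ) (X Y : Vec E M) :
    (G.lift ε X).2 Y = G.bform X Y + ((ε : ℤ) : Fn E M) * G.metric X Y := by
  rcases Int.units_eq_one_or ε with rfl | rfl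
  · simp [lift_one_snd]
  · simp [lift_neg_one_snd, sub_eq_add_neg]

/-- Orthogonality of `𝒢` gives `⟨u, v⟩ = ⟨𝒢u, 𝒢v⟩ = -⟨u, v⟩` for `u` in `C_+` and `v` in `C_-`. The
symmetry of `g` and the skewness of `b` both come from this. -/
theorem pairing_lift_opposite (X Y : Vec E M) : pairing (G.lift 1 X) (G.lift (-1) Y) = 0 := by
  have h := G.orth (G.lift 1 X) (G.lift (-1) Y)
  rw [op_lift, op_lift] at h
  ext x
  have h := congrArg (fun f : Fn E M => f x) h
  simp [pairing, Units.smul_def] at h ⊢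
  linarith

theorem metric_symm (X Y : Vec E M) : G.metric X Y = G.metric Y X := by
  have h1 := G.pairing_lift_opposite X Y
  have h2 := G.pairing_lift_opposite Y X
  simp only [pairing, lift_fst, lift_one_snd, lift_neg_one_snd] at h1 h2
  ext x
  have h1 := congrArg (fun f : Fn E M => f x) h1
  have h2 := congrArg (fun f : Fn E M => f x) h2
  simp at h1 h2
  linarith

theorem bform_swap (X Y : Vec E M) : G.bform X Y = -G.bform Y X := by
  have h1 := G.pairing_lift_opposite X Y
  simp only [pairing, lift_fst, lift_one_snd, lift_neg_one_snd] at h1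
  linear_combination h1 - G.metric_symm X Y

theorem isBilinear_bform : IsBilinear fun X Y => G.bform X Y :=
  ⟨fun Y => ⟨fun X X' => by simp, fun r X => by
      rw [LinearMap.map_smul_of_tower, LinearMap.smul_apply]⟩,
    fun X => ⟨(G.bform X).map_add, (G.bform X).map_smul_of_tower⟩⟩

theorem metric_eq (X Y : Vec E M) : G.metric X Y = (G.lift 1 X).2 Y - G.bform X Y := by
  rw [lift_one_snd]; ring

theorem isBilinear_metric : IsBilinear G.metric := by
  have h := G.isBilinear_bform
  refine ⟨fun Y => ⟨fun X X' => ?_, fun r X => ?_⟩, fun X => ⟨fun Y Y' => ?_, fun r Y => ?_⟩⟩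
  · simp only [metric_eq, map_add, Prod.snd_add, LinearMap.add_apply]; ring
  · simp only [metric_eq, LinearMap.map_smul_of_tower, Prod.smul_snd, LinearMap.smul_apply,
      smul_sub]
  · simp only [metric_eq, map_add]; ring
  · simp only [metric_eq, LinearMap.map_smul_of_tower, smul_sub]

theorem pairing_lift_lift (ε : ℤˣ) (X Y : Vec E M) :
    pairing (G.lift ε X) (G.lift ε Y) = ((ε : ℤ) : Fn E M) * (G.metric X Y + G.metric X Y) := by
  simp only [pairing, lift_fst, lift_snd]
  rw [G.bform_swap Y X, G.metric_symm Y X]; ring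

/-- Nondegeneracy of `g`: if `gX = 0`, the two lifts of `X` coincide and so lie in `C_+ ∩ C_- = 0`.
-/
theorem eq_zero_of_metric_eq_zero {X : Vec E M} (h : ∀ Y, G.metric X Y = 0) : X = 0 := by
  have h1 : G.lift 1 X = G.lift (-1) X := by
    refine Prod.ext (by simp only [lift_fst]) (LinearMap.ext fun Y => ?_)
    rw [lift_one_snd, lift_neg_one_snd, h]; simp
  have h2 := G.op_lift 1 X
  have h3 := G.op_lift (-1) X
  rw [← h1, h2, one_smul, Units.neg_smul, one_smul] at h3
  have h4 := congrArg Prod.fst h3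
  rw [Prod.fst_neg, lift_fst] at h4
  have h5 : (2 : ℝ) • X = 0 := by rw [two_smul, ← eq_neg_iff_add_eq_zero, ← h4]
  exact (smul_eq_zero.1 h5).resolve_left two_ne_zero

end GenMetric

end

/-! ### Projections to `C_±`, the Bismut connection, and skew structures. -/

section

variable {E : Type*} [NormedAddCommGroup E] [NormedSpace ℝ E] [FiniteDimensional ℝ E]
  {M : Type*} [TopologicalSpace M] [ChartedSpace E M] [IsManifold 𝓘(ℝ, E) ∞ M]

theorem pairing_add_left (u v w : Sec E M) : pairing (u + v) w = pairing u w + pairing v w := by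
  simp only [pairing, Prod.snd_add, Prod.fst_add, LinearMap.add_apply, map_add]; ring

theorem pairing_comm (u v : Sec E M) : pairing u v = pairing v u := add_comm _ _

theorem pairing_zsmul_left (n : ℤ) (u w : Sec E M) : pairing (n • u) w = n * pairing u w := by
  rw [← zsmul_eq_mul]
  exact map_zsmul (AddMonoidHom.mk' (fun u => pairing u w) fun u v => pairing_add_left u v w) n u

theorem pairing_real_smul_left (r : ℝ) (u w : Sec E M) : pairing (r • u) w = r • pairing u w := by
  simp only [pairing, Prod.smul_snd, Prod.smul_fst, LinearMap.smul_apply,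
    LinearMap.map_smul_of_tower, smul_add]

theorem lieDer_add (X Y : Vec E M) (β : Form1 E M) :
    lieDer (X + Y) β = lieDer X β + lieDer Y β := by
  ext1 Z
  simp only [lieDer, LinearMap.coe_mk, AddHom.coe_mk, LinearMap.add_apply, der_vec_add,
    bracket_add_left, map_add]
  ring

theorem contrD_add (Y : Vec E M) (α β : Form1 E M) :
    contrD Y (α + β) = contrD Y α + contrD Y β := by
  ext1 Z
  simp only [contrD, LinearMap.coe_mk, AddHom.coe_mk, LinearMap.add_apply, der_add]
  ring

theorem contrH_add (H : Form3 E M) (X X' Y : Vec E M) :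
    contrH H (X + X') Y = contrH H X Y + contrH H X' Y := by
  ext1 Z
  have h : ∀ X, H ![X, Y, Z] = H ![Y, Z, X] := fun X => by
    rw [form3_swap_left, form3_swap_right, neg_neg]
  simp only [contrH, LinearMap.coe_mk, AddHom.coe_mk, LinearMap.add_apply, h,
    (isLinearMap_form3_trd H Y Z).map_add]

theorem dorfman_add_left (H : Form3 E M) (u v w : Sec E M) :
    dorfman H (u + v) w = dorfman H u w + dorfman H v w := by
  refine Prod.ext (bracket_add_left _ _ _) ?_
  simp only [dorfman, Prod.snd_add, Prod.fst_add, lieDer_add, contrD_add, contrH_add]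
  abel

theorem dorfman_zero_right (H : Form3 E M) (u : Sec E M) : dorfman H u 0 = 0 := by
  have h1 : ∀ X : Vec E M, bracket X 0 = 0 := fun X => by
    simpa using bracket_real_smul_right 0 X 0
  have h2 : ∀ f : Fn E M, der (0 : Vec E M) f = 0 := fun f => by
    simpa using der_vec_real_smul 0 0 f
  have h3 : ∀ X : Vec E M, der X (0 : Fn E M) = 0 := fun X => by
    simpa using der_smul X 0 0
  have h4 : ∀ Z, H ![u.1, 0, Z] = 0 := fun Z => H.map_coord_zero (i := 1) rfl
  have h5 : ∀ Z : Vec E M, bracket 0 Z = 0 := fun Z => by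
    simpa using bracket_real_smul_left 0 0 Z
  refine Prod.ext (h1 _) (LinearMap.ext fun Z => ?_)
  simp [dorfman, lieDer, contrD, contrH, h2, h3, h4, h5]

namespace GenMetric

variable (G : GenMetric E M)

theorem op_proj (ε : ℤˣ) (u : Sec E M) : G.op (G.proj ε u) = ε • G.proj ε u := by
  simp only [proj, LinearMap.map_smul_of_tower, map_add, Units.smul_def, map_zsmul, G.sq]
  rw [smul_comm (ε : ℤ) (1 / 2 : ℝ), smul_add (ε : ℤ), ← mul_smul, ← Units.val_mul, Int.units_mul_self,
    Units.val_one, one_smul, add_comm]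

theorem proj_eq_lift (ε : ℤˣ) (u : Sec E M) : G.proj ε u = G.lift ε (G.proj ε u).1 :=
  G.eq_lift (G.op_proj ε u)

theorem proj_lift_self (ε : ℤˣ) (X : Vec E M) : G.proj ε (G.lift ε X) = G.lift ε X := by
  rw [proj, op_lift, ← mul_smul, Int.units_mul_self, one_smul, ← two_smul ℝ, ← mul_smul]
  norm_num

theorem proj_lift_neg (ε : ℤˣ) (X : Vec E M) : G.proj ε (G.lift (-ε) X) = 0 := by
  rw [proj, op_lift, ← mul_smul, mul_neg, Int.units_mul_self, Units.neg_smul, one_smul,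
    add_neg_cancel, smul_zero]

theorem proj_add_proj (u : Sec E M) : G.proj 1 u + G.proj (-1) u = u := by
  rw [proj, proj, ← smul_add, one_smul, Units.neg_smul, one_smul, add_add_add_comm,
    add_neg_cancel, add_zero, ← two_smul ℝ, ← mul_smul]
  norm_num

theorem proj_add (ε : ℤˣ) (u v : Sec E M) : G.proj ε (u + v) = G.proj ε u + G.proj ε v := by
  simp only [proj, map_add, smul_add]; abel

theorem proj_zero (ε : ℤˣ) : G.proj ε 0 = 0 := by simp [proj]

theorem swap_lift (ε : ℤˣ) (X : Vec E M) : G.swap (G.lift ε X) = G.lift (-ε) X := by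
  refine Prod.ext (by simp only [swap, lift_fst]) (LinearMap.ext fun Y => ?_)
  ext x
  simp [swap, lift_fst, lift_snd]; ring

/-- An orthogonal involution is self-adjoint. -/
theorem pairing_op_left (u v : Sec E M) : pairing (G.op u) v = pairing u (G.op v) := by
  rw [← G.orth (G.op u), G.sq]

theorem pairing_proj_lift (ε : ℤˣ) (u : Sec E M) (Z : Vec E M) :
    pairing (G.proj ε u) (G.lift ε Z) = pairing u (G.lift ε Z) := by
  have h := pairing_zsmul_left (ε : ℤ) (G.lift ε Z) u
  rw [proj, pairing_real_smul_left, pairing_add_left, Units.smul_def, pairing_zsmul_left,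
    pairing_op_left, op_lift, Units.smul_def, pairing_comm u (_ • _), h, pairing_comm _ u]
  ext x
  rcases Int.units_eq_one_or ε with rfl | rfl <;> simp <;> ring

theorem proj_fst_add_proj_fst (u : Sec E M) :
    (G.proj 1 u).1 + (G.proj (-1) u).1 = u.1 := congrArg Prod.fst (G.proj_add_proj u)

end GenMetric

/-- `C` exchanges the lifts of a vector field to `C_+` and `C_-`, so `u_- + C u_+` and `u_+ + C u_-`
are the two lifts of `π u`. Additivity of the bracket in its first argument then merges the four
terms into two. -/
theorem bismut_eq (H : Form3 E M) (G : GenMetric E M) (u v : Sec E M) :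
    bismut H G u v = G.proj 1 (dorfman H (G.lift (-1) u.1) (G.proj 1 v))
      + G.proj (-1) (dorfman H (G.lift 1 u.1) (G.proj (-1) v)) := by
  have h1 : G.lift (-1) u.1 = G.proj (-1) u + G.swap (G.proj 1 u) := by
    rw [G.proj_eq_lift 1 u, G.swap_lift, G.proj_eq_lift (-1) u, ← map_add, add_comm,
      G.proj_fst_add_proj_fst]
  have h2 : G.lift 1 u.1 = G.proj 1 u + G.swap (G.proj (-1) u) := by
    rw [G.proj_eq_lift (-1) u, G.swap_lift, neg_neg, G.proj_eq_lift 1 u, ← map_add,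
      G.proj_fst_add_proj_fst]
  rw [h1, h2, dorfman_add_left, dorfman_add_left, G.proj_add, G.proj_add, bismut]
  abel

/-- An endomorphism of `T ⊕ T^*` that commutes with `𝒢`, is skew for the pairing and has square
`κ = ±1`: the common generalization of almost generalized Kähler structures (`κ = -1`) and almost
generalized para-Kähler structures (`κ = 1`). -/
structure IsSkewStructure (κ : ℤ) (G : GenMetric E M) (A : EndSec E M) : Prop where
  sq : ∀ u, A (A u) = κ • u
  skew : ∀ u v, pairing (A u) v = -pairing u (A v)
  comm : ∀ u, G.op (A u) = A (G.op u)

theorem IsAlmostGK.isSkewStructure {G : GenMetric E M} {A : EndSec E M} (h : IsAlmostGK G A) :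
    IsSkewStructure (-1) G A where
  sq u := by rw [h.sq, neg_one_zsmul]
  skew u v := by
    rw [← h.orth u, h.sq, pairing_comm _ (-v), pairing_comm _ v, ← neg_one_zsmul v,
      pairing_zsmul_left]
    simp
  comm := h.comm

theorem IsAlmostGpK.isSkewStructure {G : GenMetric E M} {A : EndSec E M} (h : IsAlmostGpK G A) :
    IsSkewStructure 1 G A where
  sq u := by rw [h.sq, one_zsmul]
  skew u v := by rw [← neg_eq_iff_eq_neg, ← h.orth, h.sq]
  comm := h.comm

/-- Twice the covariant derivative `g(∇_X Y, Z)` of the Levi-Civita connection of the metric of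
`𝒢`, by the Koszul formula. -/
def koszul (G : GenMetric E M) (X Y Z : Vec E M) : Fn E M :=
  der X (G.metric Y Z) + der Y (G.metric X Z) - der Z (G.metric X Y) + G.metric (bracket X Y) Z
    - G.metric (bracket X Z) Y - G.metric (bracket Y Z) X

/-- The cotangent parts are `(b - εg)X` and `(b + εg)Y`, `(b + εg)Z`. The `b`-terms add up to `db`,
and thanks to the opposite sign on `X` the `g`-terms form the Koszul expression. -/
theorem pairing_dorfman_lift (H : Form3 E M) (G : GenMetric E M) (ε : ℤˣ) (X Y Z : Vec E M) :
    pairing (dorfman H (G.lift (-ε) X) (G.lift ε Y)) (G.lift ε Z)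
      = ((ε : ℤ) : Fn E M) * koszul G X Y Z + flux H G X Y Z := by
  have b1 := G.bform_swap Z (bracket X Y)
  have b2 := G.bform_swap Y (bracket X Z)
  have b3 := G.bform_swap X (bracket Y Z)
  have g1 := G.metric_symm Z (bracket X Y)
  have g2 := G.metric_symm Y (bracket X Z)
  have g3 := G.metric_symm X (bracket Y Z)
  rcases Int.units_eq_one_or ε with rfl | rfl <;>
    simp [pairing, dorfman, GenMetric.lift_fst, GenMetric.lift_one_snd,
      GenMetric.lift_neg_one_snd, lieDer, contrD, contrH, flux, extD, koszul, der_add, der_sub,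
      b1, b2, b3, g1, g2, g3]
  all_goals ring

namespace IsSkewStructure

variable {κ : ℤ} {G : GenMetric E M} {A : EndSec E M}

theorem proj_comm (h : IsSkewStructure κ G A) (ε : ℤˣ) (u : Sec E M) :
    G.proj ε (A u) = A (G.proj ε u) := by
  simp only [GenMetric.proj, h.comm, LinearMap.map_smul_of_tower, map_add]

theorem apply_lift (h : IsSkewStructure κ G A) (ε : ℤˣ) (X : Vec E M) :
    A (G.lift ε X) = G.lift ε (tangentEnd G A ε X) := by
  refine G.eq_lift ?_
  rw [h.comm, G.op_lift, Units.smul_def, map_zsmul, Units.smul_def]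

theorem tangentEnd_tangentEnd (h : IsSkewStructure κ G A) (ε : ℤˣ) (X : Vec E M) :
    tangentEnd G A ε (tangentEnd G A ε X) = κ • X := by
  rw [tangentEnd, ← h.apply_lift, h.sq, Prod.smul_fst, G.lift_fst]

theorem isLinearMap_tangentEnd (G : GenMetric E M) (A : EndSec E M) (ε : ℤˣ) :
    IsLinearMap ℝ (tangentEnd G A ε) :=
  ⟨fun X Y => by simp only [tangentEnd, map_add, Prod.fst_add], fun r X => by
    simp only [tangentEnd, LinearMap.map_smul_of_tower, Prod.smul_fst]⟩

theorem metric_tangentEnd (h : IsSkewStructure κ G A) (ε : ℤˣ) (X Y : Vec E M) :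
    G.metric (tangentEnd G A ε X) Y = -G.metric X (tangentEnd G A ε Y) := by
  have h1 := h.skew (G.lift ε X) (G.lift ε Y)
  rw [h.apply_lift, h.apply_lift, G.pairing_lift_lift, G.pairing_lift_lift] at h1
  ext x
  have h1 := congrArg (fun f : Fn E M => f x) h1
  rcases Int.units_eq_one_or ε with rfl | rfl <;> simp at h1 ⊢ <;> linarith

/-- Both `D_u` and `A` are block diagonal for `C_+ ⊕ C_-`, so the condition can be tested on each
block separately. -/
theorem weaklyIntegrable_iff_proj (h : IsSkewStructure κ G A) (H : Form3 E M) :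
    WeaklyIntegrable H G A ↔ ∀ (ε : ℤˣ) (X Y : Vec E M),
      G.proj ε (dorfman H (G.lift (-ε) X) (G.lift ε (tangentEnd G A ε Y)))
        - A (G.proj ε (dorfman H (G.lift (-ε) X) (G.lift ε Y))) = 0 := by
  constructor
  · intro hw ε X Y
    have h0 := dorfman_zero_right H
    -- Either lift of `X` would do for `u`, since only its anchor enters.
    have h1 := hw (G.lift 1 X) (G.lift ε Y)
    rw [bismut_eq, bismut_eq, h.apply_lift, G.lift_fst] at h1
    rcases Int.units_eq_one_or ε with rfl | rfl
    · have e := G.proj_lift_neg (-1)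
      rw [neg_neg] at e
      simpa [G.proj_lift_self, e, h0, G.proj_zero] using h1
    · simpa [G.proj_lift_self, G.proj_lift_neg, h0, G.proj_zero] using h1
  · intro hp u v
    have h1 := hp 1 u.1 (G.proj 1 v).1
    have h2 := hp (-1) u.1 (G.proj (-1) v).1
    rw [← h.apply_lift, ← G.proj_eq_lift] at h1 h2
    rw [bismut_eq, bismut_eq, h.proj_comm, h.proj_comm, map_add, add_sub_add_comm, h1]
    rw [neg_neg] at h2
    rw [h2, add_zero]

end IsSkewStructure

end

/-! ### The Levi-Civita derivative of the fundamental form. -/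

section

variable {E : Type*} [NormedAddCommGroup E] [NormedSpace ℝ E] [FiniteDimensional ℝ E]
  {M : Type*} [TopologicalSpace M] [ChartedSpace E M] [IsManifold 𝓘(ℝ, E) ∞ M]

theorem isTrilinear_koszul (G : GenMetric E M) : IsTrilinear (koszul G) := by
  have hβ := G.isBilinear_metric
  have l1 := fun Y => (hβ.fst Y).map_add
  have l2 := fun Y => (hβ.fst Y).map_smul
  have r1 := fun X => (hβ.snd X).map_add
  have r2 := fun X => (hβ.snd X).map_smul
  constructor <;> intro _ _ <;> constructor <;> intros <;>
    simp only [koszul, l1, l2, r1, r2, der_add, der_smul, der_vec_add, der_vec_real_smul,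
      bracket_add_left, bracket_add_right, bracket_real_smul_left, bracket_real_smul_right,
      smul_sub, smul_add] <;> abel

/-- Torsion-freeness of the Levi-Civita connection, doubled like the Koszul expression. -/
theorem koszul_sub_koszul (G : GenMetric E M) (X Y Z : Vec E M) :
    koszul G X Y Z - koszul G Y X Z = G.metric (bracket X Y) Z + G.metric (bracket X Y) Z := by
  have h : G.metric (bracket Y X) Z = -G.metric (bracket X Y) Z := by
    rw [bracket_swap, (G.isBilinear_metric.fst Z).map_neg]
  simp only [koszul]
  rw [h, G.metric_symm X Y]; ring

theorem isBilinear_fundForm (G : GenMetric E M) (A : EndSec E M) (ε : ℤˣ) :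
    IsBilinear (fundForm G A ε) := by
  have h := IsSkewStructure.isLinearMap_tangentEnd G A ε
  have hβ := G.isBilinear_metric
  refine ⟨fun Y => ⟨fun X X' => ?_, fun r X => ?_⟩, fun X => hβ.snd _⟩
  · simp only [fundForm, h.map_add, (hβ.fst Y).map_add]
  · simp only [fundForm, h.map_smul, (hβ.fst Y).map_smul]

theorem isTrilinear_flux (H : Form3 E M) (G : GenMetric E M) : IsTrilinear (flux H G) := by
  have h := isTrilinear_extD G.isBilinear_bform
  have k := isLinearMap_form3_trd H
  have e1 : ∀ X Y Z, H ![X, Y, Z] = H ![Y, Z, X] := fun X Y Z => by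
    rw [form3_swap_left, form3_swap_right, neg_neg]
  have e2 : ∀ X Y Z, H ![X, Y, Z] = H ![Z, X, Y] := fun X Y Z => by rw [e1, e1]
  refine ⟨fun Y Z => ⟨fun X X' => ?_, fun r X => ?_⟩, fun X Z => ⟨fun Y Y' => ?_, fun r Y => ?_⟩,
    fun X Y => ⟨fun Z Z' => ?_, fun r Z => ?_⟩⟩
  · simp only [flux, e1 _ Y Z, (k Y Z).map_add, (h.fst Y Z).map_add]; ring
  · simp only [flux, e1 _ Y Z, (k Y Z).map_smul, (h.fst Y Z).map_smul, smul_add]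
  · simp only [flux, e2 X _ Z, (k Z X).map_add, (h.snd X Z).map_add]; ring
  · simp only [flux, e2 X _ Z, (k Z X).map_smul, (h.snd X Z).map_smul, smul_add]
  · simp only [flux, (k X Y).map_add, (h.trd X Y).map_add]; ring
  · simp only [flux, (k X Y).map_smul, (h.trd X Y).map_smul, smul_add]

theorem flux_swap_left (H : Form3 E M) (G : GenMetric E M) (X Y Z : Vec E M) :
    flux H G X Y Z = -flux H G Y X Z := by
  rw [flux, flux, form3_swap_left, extD_swap_left G.isBilinear_bform G.bform_swap]; ring

theorem flux_swap_right (H : Form3 E M) (G : GenMetric E M) (X Y Z : Vec E M) :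
    flux H G X Y Z = -flux H G X Z Y := by
  rw [flux, flux, form3_swap_right, extD_swap_right G.isBilinear_bform G.bform_swap]; ring

/-- Twice the covariant derivative `(∇_X ω_ε)(Y, Z)` of the fundamental form `ω_ε` with respect to
the Levi-Civita connection. -/
def covFund (G : GenMetric E M) (A : EndSec E M) (ε : ℤˣ) (X Y Z : Vec E M) : Fn E M :=
  koszul G X (tangentEnd G A ε Y) Z + koszul G X Y (tangentEnd G A ε Z)

theorem GenMetric.eq_zero_of_pairing_lift (G : GenMetric E M) {ε : ℤˣ} {u : Sec E M}
    (hu : G.op u = ε • u) (h : ∀ Z, pairing u (G.lift ε Z) = 0) : u = 0 := by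
  rw [G.eq_lift hu, G.eq_zero_of_metric_eq_zero (X := u.1), map_zero]
  intro Z
  have h1 := h Z
  rw [G.eq_lift hu, G.pairing_lift_lift] at h1
  ext x
  have h1 := congrArg (fun f : Fn E M => f x) h1
  rcases Int.units_eq_one_or ε with rfl | rfl <;> simp at h1 ⊢ <;> linarith

namespace IsSkewStructure

variable {κ : ℤ} {G : GenMetric E M} {A : EndSec E M}

theorem isTrilinear_covFund (G : GenMetric E M) (A : EndSec E M) (ε : ℤˣ) :
    IsTrilinear (covFund G A ε) := by
  have h := isLinearMap_tangentEnd G A ε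
  have k := isTrilinear_koszul G
  refine ⟨fun Y Z => ⟨fun X X' => ?_, fun r X => ?_⟩, fun X Z => ⟨fun Y Y' => ?_, fun r Y => ?_⟩,
    fun X Y => ⟨fun Z Z' => ?_, fun r Z => ?_⟩⟩ <;>
  simp only [covFund, h.map_add, h.map_smul, (k.fst _ _).map_add, (k.fst _ _).map_smul,
    (k.snd _ _).map_add, (k.snd _ _).map_smul, (k.trd _ _).map_add, (k.trd _ _).map_smul,
    smul_add] <;> abel

/-- Metric compatibility of the connection, recorded as `k`, transfers the skewness of `ω` to its
covariant derivative. -/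
theorem covFund_swap (h : IsSkewStructure κ G A) (ε : ℤˣ) (X Y Z : Vec E M) :
    covFund G A ε X Y Z = -covFund G A ε X Z Y := by
  have k : ∀ X Y Z, koszul G X Y Z + koszul G X Z Y
      = der X (G.metric Y Z) + der X (G.metric Y Z) := fun X Y Z => by
    have e : G.metric (bracket Z Y) X = -G.metric (bracket Y Z) X := by
      rw [bracket_swap, (G.isBilinear_metric.fst X).map_neg]
    simp only [koszul]
    rw [e, G.metric_symm Z Y]; ring
  have k1 := k X (tangentEnd G A ε Y) Z
  have k2 := k X Y (tangentEnd G A ε Z)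
  rw [h.metric_tangentEnd, der_neg] at k1
  simp only [covFund]
  linear_combination k1 + k2

theorem extD_fundForm (h : IsSkewStructure κ G A) (ε : ℤˣ) (X Y Z : Vec E M) :
    extD (fundForm G A ε) X Y Z + extD (fundForm G A ε) X Y Z
      = covFund G A ε X Y Z + covFund G A ε Y Z X + covFund G A ε Z X Y := by
  have s := G.metric_symm
  have m := h.metric_tangentEnd ε
  have e : ∀ X Y Z, G.metric (bracket X Y) Z = -G.metric (bracket Y X) Z := fun X Y Z => by
    rw [bracket_swap, (G.isBilinear_metric.fst Z).map_neg]
  simp only [extD, fundForm, covFund, koszul, m, der_neg]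
  have m' : ∀ X Y, G.metric Y (tangentEnd G A ε X) = -G.metric X (tangentEnd G A ε Y) :=
    fun X Y => by rw [s, m]
  rw [m' Y Z, m' X Y, m' X Z, s Y X, s Z Y, s Z X, e Y X, e Z Y, e Z X,
    e (tangentEnd G A ε Z) X, e (tangentEnd G A ε X) Y, e (tangentEnd G A ε Y) Z]
  simp only [der_neg]
  ring

/-- Each of the four brackets in the Nijenhuis tensor becomes a difference of covariant derivatives
by torsion-freeness. Skewness of `A` moves the outer `A` onto `Z`. -/
theorem nijTensor_eq (h : IsSkewStructure κ G A) (ε : ℤˣ) (X Y Z : Vec E M) :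
    nijTensor G A ε X Y Z + nijTensor G A ε X Y Z
      = covFund G A ε (tangentEnd G A ε X) Y Z - covFund G A ε (tangentEnd G A ε Y) X Z
        + covFund G A ε X Y (tangentEnd G A ε Z) - covFund G A ε Y X (tangentEnd G A ε Z) := by
  have hg := G.isBilinear_metric
  have hk : ∀ X Y Z, koszul G X Y (κ • Z) = κ • koszul G X Y Z := fun X Y Z =>
    map_zsmul (((isTrilinear_koszul G).trd X Y).mk').toAddMonoidHom κ Z
  have hz : ∀ X Z, G.metric (κ • X) Z = κ • G.metric X Z := fun X Z =>
    map_zsmul ((hg.fst Z).mk').toAddMonoidHom κ X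
  have k := koszul_sub_koszul G
  simp only [nijTensor, nijenhuis, covFund, h.tangentEnd_tangentEnd, (hg.fst Z).map_sub,
    (hg.fst Z).map_add, h.metric_tangentEnd ε (_ + _) Z, (hg.fst _).map_add, hk, hz,
    zsmul_eq_mul]
  linear_combination -k (tangentEnd G A ε X) (tangentEnd G A ε Y) Z
    - k (tangentEnd G A ε X) Y (tangentEnd G A ε Z) - k X (tangentEnd G A ε Y) (tangentEnd G A ε Z)
    - κ * k X Y Z

/-- The defect in `C_ε` is itself a section of `C_ε`, where the pairing is `2εg` and hence
nondegenerate. It therefore vanishes as soon as its pairings with all lifts to `C_ε` do. -/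
theorem weaklyIntegrable_iff (h : IsSkewStructure κ G A) (H : Form3 E M) :
    WeaklyIntegrable H G A ↔ ∀ (ε : ℤˣ) (X Y Z : Vec E M),
      ((ε : ℤ) : Fn E M) * covFund G A ε X Y Z + flux H G X (tangentEnd G A ε Y) Z
        + flux H G X Y (tangentEnd G A ε Z) = 0 := by
  rw [h.weaklyIntegrable_iff_proj]
  have key : ∀ (ε : ℤˣ) (X Y Z : Vec E M),
      pairing (G.proj ε (dorfman H (G.lift (-ε) X) (G.lift ε (tangentEnd G A ε Y)))
        - A (G.proj ε (dorfman H (G.lift (-ε) X) (G.lift ε Y)))) (G.lift ε Z)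
      = ((ε : ℤ) : Fn E M) * covFund G A ε X Y Z + flux H G X (tangentEnd G A ε Y) Z
        + flux H G X Y (tangentEnd G A ε Z) := fun ε X Y Z => by
    rw [sub_eq_add_neg, pairing_add_left, ← neg_one_zsmul, pairing_zsmul_left, h.skew,
      h.apply_lift, G.pairing_proj_lift, G.pairing_proj_lift, pairing_dorfman_lift,
      pairing_dorfman_lift, covFund]
    push_cast
    ring
  refine forall₃_congr fun ε X Y => ⟨fun h0 Z => ?_, fun h0 => ?_⟩
  · rw [← key, h0]; simp [pairing]
  · simp only [← key] at h0
    refine G.eq_zero_of_pairing_lift (ε := ε) ?_ h0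
    rw [map_sub, h.comm, G.op_proj, G.op_proj, Units.smul_def, Units.smul_def, map_zsmul,
      smul_sub, Units.smul_def, Units.smul_def]

end IsSkewStructure

end

/-! ### Algebra of the parallelism equation at a fixed point. -/

section

variable {V : Type*} [AddCommGroup V] {A : V → V} {κ : ℤ}

/-- The algebraic identities of the covariant derivative of the fundamental form of a skew
endomorphism `A` with `A² = κ`. -/
structure IsCovFundLike (A : V → V) (κ : ℤ) (S : V → V → V → ℝ) : Prop where
  fst : ∀ X Y Z, S (κ • X) Y Z = κ * S X Y Z
  trd : ∀ X Y Z, S X Y (κ • Z) = κ * S X Y Z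
  swap : ∀ X Y Z, S X Y Z = -S X Z Y
  left : ∀ X Y Z, S X (A Y) Z = S X Y (A Z)

/-- The three expressions are the pure part of the cyclic sum (up to an invertible twist by `A`),
the Nijenhuis combination, which sees only pure types, and the mixed part of the cyclic sum. Only
homogeneity for `κ` is used, so `V` can be the space of vector fields and no tensoriality is needed.
-/
theorem IsCovFundLike.eq_zero_iff {S : V → V → V → ℝ} (hS : IsCovFundLike A κ S)
    (hκ : κ * κ = 1) (hA : ∀ X, A (A X) = κ • X) :
    (∀ X Y Z, S X Y Z = 0) ↔ ∀ X Y Z,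
      (S (A X) Y Z + S Y Z (A X) + S Z (A X) Y) + (S X (A Y) Z + S (A Y) Z X + S Z X (A Y))
        + (S X Y (A Z) + S Y (A Z) X + S (A Z) X Y)
        + κ * (S (A X) (A Y) (A Z) + S (A Y) (A Z) (A X) + S (A Z) (A X) (A Y)) = 0 ∧
      S (A X) Y Z - S (A Y) X Z + S X Y (A Z) - S Y X (A Z) = 0 ∧
      3 * (S X Y Z + S Y Z X + S Z X Y)
        - κ * ((S X (A Y) (A Z) + S (A Y) (A Z) X + S (A Z) X (A Y))
          + (S (A X) Y (A Z) + S Y (A Z) (A X) + S (A Z) (A X) Y)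
          + (S (A X) (A Y) Z + S (A Y) Z (A X) + S Z (A X) (A Y))) = 0 := by
  have hκ' : (κ : ℝ) * κ = 1 := by exact_mod_cast hκ
  constructor
  · intro h X Y Z
    simp [h]
  · intro h X Y Z
    -- On pure types `a` is the cyclic sum and `n` is `S Y Z X + S Z X Y`, up to factors, so
    -- together they isolate the pure part of `S X Y Z`. The extra `A` makes the total power of `A`
    -- even. In `c + κ c'` only the types with `Y` and `Z` equal and `X` opposite survive, which is
    -- the mixed part of `S X Y Z`.
    have a := (h (A X) Y Z).1
    have n := (h Y Z (A X)).2.1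
    have c := (h X Y Z).2.2
    have c' := (h X (A Y) (A Z)).2.2
    have hS2 : ∀ X Y Z, S X (κ • Y) Z = κ * S X Y Z := fun X Y Z => by
      rw [hS.swap, hS.trd, hS.swap X Y]; ring
    have hA' : ∀ X, A (κ • X) = κ • A X := fun X => by rw [← hA, hA]
    have s1 := hS.swap (A Z) Y (A X)
    have s2 := hS.swap Z Y X
    have s3 := hS.swap Z Y (A X)
    simp only [hS.left, hA, hA', hS.fst, hS2, hS.trd] at a n c c' s1 s2 s3
    rcases mul_self_eq_one_iff.1 hκ' with h1 | h1 <;> rw [h1] at a n c c' <;> linarith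

/-- An alternating function of three arguments that is homogeneous for `κ`. -/
structure IsFluxLike (κ : ℤ) (h : V → V → V → ℝ) : Prop where
  trd : ∀ X Y Z, h X Y (κ • Z) = κ * h X Y Z
  swap_left : ∀ X Y Z, h X Y Z = -h Y X Z
  swap_right : ∀ X Y Z, h X Y Z = -h X Z Y

theorem IsFluxLike.cycle {h : V → V → V → ℝ} (hh : IsFluxLike κ h) (X Y Z : V) :
    h X Y Z = h Y Z X := by rw [hh.swap_left, hh.swap_right, neg_neg]

theorem IsFluxLike.snd {h : V → V → V → ℝ} (hh : IsFluxLike κ h) (X Y Z : V) :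
    h X (κ • Y) Z = κ * h X Y Z := by rw [hh.swap_right, hh.trd, hh.swap_right X Y]; ring

theorem IsFluxLike.fst {h : V → V → V → ℝ} (hh : IsFluxLike κ h) (X Y Z : V) :
    h (κ • X) Y Z = κ * h X Y Z := by rw [hh.swap_left, hh.snd, hh.swap_left X Y]; ring

/-- The parallelism condition `ε S(X, Y, Z) + h(X, A Y, Z) + h(X, Y, A Z) = 0` in terms of the
exterior derivative `w` and the Nijenhuis tensor `n`. -/
theorem parallel_iff {S h w n : V → V → V → ℝ} {ε : ℝ} (hS : IsCovFundLike A κ S)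
    (hh : IsFluxLike κ h) (hε : ε * ε = 1) (hκ : κ * κ = 1) (hA : ∀ X, A (A X) = κ • X)
    (hw : ∀ X Y Z, w X Y Z + w X Y Z = S X Y Z + S Y Z X + S Z X Y)
    (hn : ∀ X Y Z, n X Y Z + n X Y Z
      = S (A X) Y Z - S (A Y) X Z + S X Y (A Z) - S Y X (A Z)) :
    (∀ X Y Z, ε * S X Y Z + h X (A Y) Z + h X Y (A Z) = 0) ↔ ∀ X Y Z,
      (w (A X) Y Z + w X (A Y) Z + w X Y (A Z) + κ * w (A X) (A Y) (A Z)
        = -3 * ε * (κ * h X Y Z + (h X (A Y) (A Z) + h (A X) Y (A Z) + h (A X) (A Y) Z))) ∧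
      (n X Y Z
        = -ε * (κ * h X Y Z + (h X (A Y) (A Z) + h (A X) Y (A Z) + h (A X) (A Y) Z))) ∧
      (3 * w X Y Z - κ * (w X (A Y) (A Z) + w (A X) Y (A Z) + w (A X) (A Y) Z)
        = -ε * (h (A X) Y Z + h X (A Y) Z + h X Y (A Z) - 3 * κ * h (A X) (A Y) (A Z))) := by
  have hA' : ∀ X, A (κ • X) = κ • A X := fun X => by rw [← hA, hA]
  have hκ' : (κ : ℝ) * κ = 1 := by exact_mod_cast hκ
  -- `D` is `ε` times the left-hand side, as `ε² = 1`. The flux term has the same symmetries as `S`,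
  -- so the criterion for vanishing applies to `D`.
  set D : V → V → V → ℝ := fun X Y Z => S X Y Z + ε * (h X (A Y) Z + h X Y (A Z)) with hD
  have hDS : IsCovFundLike A κ D := by
    constructor <;> intro X Y Z <;> simp only [hD, hS.fst, hS.trd, hh.fst, hh.trd, hA, hA', hh.snd]
    · ring
    · ring
    · rw [hS.swap X Y, hh.swap_right X (A Y), hh.swap_right X Y]; ring
    · rw [hS.left]; ring
  have h1 : (∀ X Y Z, ε * S X Y Z + h X (A Y) Z + h X Y (A Z) = 0) ↔ ∀ X Y Z, D X Y Z = 0 := by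
    refine forall₃_congr fun X Y Z => ⟨fun H => ?_, fun H => ?_⟩
    · simp only [hD]; linear_combination ε * H - S X Y Z * hε
    · simp only [hD] at H; linear_combination ε * H - (h X (A Y) Z + h X Y (A Z)) * hε
  -- In the cyclic sum each flux term with one `A` occurs twice.
  have hw' : ∀ X Y Z, w X Y Z + w X Y Z = D X Y Z + D Y Z X + D Z X Y
      - 2 * ε * (h (A X) Y Z + h X (A Y) Z + h X Y (A Z)) := fun X Y Z => by
    simp only [hw, hD]
    rw [hh.cycle X (A Y) Z, hh.cycle X Y (A Z), hh.cycle (A X) Y Z, hh.cycle Y Z (A X),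
      hh.cycle Y (A Z) X, hh.cycle (A Y) Z X]
    ring
  have hn' : ∀ X Y Z, n X Y Z + n X Y Z = D (A X) Y Z - D (A Y) X Z + D X Y (A Z) - D Y X (A Z)
      - 2 * ε * (κ * h X Y Z + (h X (A Y) (A Z) + h (A X) Y (A Z) + h (A X) (A Y) Z)) :=
    fun X Y Z => by
    simp only [hn, hD, hA, hh.trd]
    rw [hh.swap_left (A Y) (A X) Z, hh.swap_left (A Y) X, hh.swap_left Y (A X),
      hh.swap_left Y X]
    ring
  rw [h1, hDS.eq_zero_iff hκ hA]
  refine forall₃_congr fun X Y Z => and_congr ?_ (and_congr ?_ ?_)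
  · have w1 := hw' (A X) Y Z
    have w2 := hw' X (A Y) Z
    have w3 := hw' X Y (A Z)
    have w4 := hw' (A X) (A Y) (A Z)
    simp only [hA, hh.fst, hh.snd, hh.trd] at w1 w2 w3 w4
    rcases mul_self_eq_one_iff.1 hκ' with e | e <;> simp only [e] at * <;>
      constructor <;> intro H <;> linarith
  · have w1 := hn' X Y Z
    constructor <;> intro H <;> linarith
  · have w1 := hw' X (A Y) (A Z)
    have w2 := hw' (A X) Y (A Z)
    have w3 := hw' (A X) (A Y) Z
    have w4 := hw' X Y Z
    simp only [hA, hh.fst, hh.snd, hh.trd] at w1 w2 w3 w4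
    rcases mul_self_eq_one_iff.1 hκ' with e | e <;> simp only [e] at * <;>
      constructor <;> intro H <;> linarith

end

/-! ### Type components as explicit combinations of tensor values. -/

section

variable {E : Type*} [NormedAddCommGroup E] [NormedSpace ℝ E]
  {M : Type*} [TopologicalSpace M] [ChartedSpace E M] [IsManifold 𝓘(ℝ, E) ∞ M]

theorem filter_signs_three :
    (Finset.univ.filter fun σ : Fin 3 → ℤˣ => (Finset.univ.filter fun i => σ i = 1).card = 3)
      = {![1, 1, 1]} := by decide

theorem filter_signs_two :
    (Finset.univ.filter fun σ : Fin 3 → ℤˣ => (Finset.univ.filter fun i => σ i = 1).card = 2)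
      = {![1, 1, -1], ![1, -1, 1], ![-1, 1, 1]} := by decide

theorem filter_signs_one :
    (Finset.univ.filter fun σ : Fin 3 → ℤˣ => (Finset.univ.filter fun i => σ i = 1).card = 1)
      = {![1, -1, -1], ![-1, 1, -1], ![-1, -1, 1]} := by decide

theorem filter_signs_zero :
    (Finset.univ.filter fun σ : Fin 3 → ℤˣ => (Finset.univ.filter fun i => σ i = 1).card = 0)
      = {![-1, -1, -1]} := by decide

variable (I : Vec E M → Vec E M) (t : Vec E M → Vec E M → Vec E M → Fn E M) (X Y Z : Vec E M)
  (x : M)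

/-- The sum of the values of a tensor with `I` applied to one argument. -/
def applyOne : ℝ := t (I X) Y Z x + t X (I Y) Z x + t X Y (I Z) x

/-- The sum of the values of a tensor with `I` applied to two arguments. -/
def applyTwo : ℝ := t X (I Y) (I Z) x + t (I X) Y (I Z) x + t (I X) (I Y) Z x

/-- Expansion of the product of three factors `(1 - iI)/2`. The projections act on forms by an
explicit formula, so no linearity of `t` is required. -/
theorem complexType_three : complexType I 3 t X Y Z x
    = ((t X Y Z x - applyTwo I t X Y Z x : ℝ)
      - Complex.I * (applyOne I t X Y Z x - t (I X) (I Y) (I Z) x : ℝ)) / 8 := by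
  rw [complexType, filter_signs_three, Finset.sum_singleton]
  simp [complexProj, applyOne, applyTwo]
  ring_nf
  simp only [Complex.I_sq, Complex.I_pow_three]
  ring

theorem complexType_zero : complexType I 0 t X Y Z x
    = ((t X Y Z x - applyTwo I t X Y Z x : ℝ)
      + Complex.I * (applyOne I t X Y Z x - t (I X) (I Y) (I Z) x : ℝ)) / 8 := by
  rw [complexType, filter_signs_zero, Finset.sum_singleton]
  simp [complexProj, applyOne, applyTwo]
  ring_nf
  simp only [Complex.I_sq, Complex.I_pow_three]
  ring

theorem complexType_two : complexType I 2 t X Y Z x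
    = ((3 * t X Y Z x + applyTwo I t X Y Z x : ℝ)
      - Complex.I * (applyOne I t X Y Z x + 3 * t (I X) (I Y) (I Z) x : ℝ)) / 8 := by
  rw [complexType, filter_signs_two, Finset.sum_insert (by decide), Finset.sum_insert (by decide),
    Finset.sum_singleton]
  simp [complexProj, applyOne, applyTwo]
  ring_nf
  simp only [Complex.I_sq, Complex.I_pow_three]
  ring

theorem complexType_one : complexType I 1 t X Y Z x
    = ((3 * t X Y Z x + applyTwo I t X Y Z x : ℝ)
      + Complex.I * (applyOne I t X Y Z x + 3 * t (I X) (I Y) (I Z) x : ℝ)) / 8 := by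
  rw [complexType, filter_signs_one, Finset.sum_insert (by decide), Finset.sum_insert (by decide),
    Finset.sum_singleton]
  simp [complexProj, applyOne, applyTwo]
  ring_nf
  simp only [Complex.I_sq, Complex.I_pow_three]
  ring

variable {I t}

/-- Unlike the complex projections, these act on the vector fields themselves, so real trilinearity
is needed for the expansion. -/
theorem IsTrilinear.apply_paraProj (ht : IsTrilinear t) (a b c : ℤˣ) :
    t (paraProj I a X) (paraProj I b Y) (paraProj I c Z) x
      = (t X Y Z x + (a : ℤ) * t (I X) Y Z x + (b : ℤ) * t X (I Y) Z x
        + (c : ℤ) * t X Y (I Z) x + (a : ℤ) * (b : ℤ) * t (I X) (I Y) Z x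
        + (a : ℤ) * (c : ℤ) * t (I X) Y (I Z) x + (b : ℤ) * (c : ℤ) * t X (I Y) (I Z) x
        + (a : ℤ) * (b : ℤ) * (c : ℤ) * t (I X) (I Y) (I Z) x) / 8 := by
  have e : ∀ (a : ℤˣ) X, paraProj I a X = (1 / 2 : ℝ) • (X + ((a : ℤ) : ℝ) • I X) :=
    fun a X => by rw [paraProj, Int.cast_smul_eq_zsmul, Units.smul_def]
  simp only [e, (ht.fst _ _).map_add, (ht.fst _ _).map_smul, (ht.snd _ _).map_add,
    (ht.snd _ _).map_smul, (ht.trd _ _).map_add, (ht.trd _ _).map_smul]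
  simp
  ring

theorem paraType_three (ht : IsTrilinear t) : paraType I 3 t X Y Z x
    = (t X Y Z x + applyOne I t X Y Z x + applyTwo I t X Y Z x + t (I X) (I Y) (I Z) x) / 8 := by
  rw [paraType, filter_signs_three, Finset.sum_singleton]
  simp [ht.apply_paraProj X Y Z x, applyOne, applyTwo]
  ring

theorem paraType_zero (ht : IsTrilinear t) : paraType I 0 t X Y Z x
    = (t X Y Z x - applyOne I t X Y Z x + applyTwo I t X Y Z x - t (I X) (I Y) (I Z) x) / 8 := by
  rw [paraType, filter_signs_zero, Finset.sum_singleton]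
  simp [ht.apply_paraProj X Y Z x, applyOne, applyTwo]
  ring

theorem paraType_two (ht : IsTrilinear t) : paraType I 2 t X Y Z x
    = (3 * t X Y Z x + applyOne I t X Y Z x - applyTwo I t X Y Z x
      - 3 * t (I X) (I Y) (I Z) x) / 8 := by
  rw [paraType, filter_signs_two, Finset.sum_insert (by decide), Finset.sum_insert (by decide),
    Finset.sum_singleton]
  simp [ht.apply_paraProj X Y Z x, applyOne, applyTwo]
  ring

theorem paraType_one (ht : IsTrilinear t) : paraType I 1 t X Y Z x
    = (3 * t X Y Z x - applyOne I t X Y Z x - applyTwo I t X Y Z x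
      + 3 * t (I X) (I Y) (I Z) x) / 8 := by
  rw [paraType, filter_signs_one, Finset.sum_insert (by decide), Finset.sum_insert (by decide),
    Finset.sum_singleton]
  simp [ht.apply_paraProj X Y Z x, applyOne, applyTwo]
  ring

end

/-! ### Purity of the Nijenhuis tensor and the two integrability criteria. -/

section

variable {E : Type*} [NormedAddCommGroup E] [NormedSpace ℝ E] [FiniteDimensional ℝ E]
  {M : Type*} [TopologicalSpace M] [ChartedSpace E M] [IsManifold 𝓘(ℝ, E) ∞ M]

theorem IsTrilinear.trd_zsmul {t : Vec E M → Vec E M → Vec E M → Fn E M} (ht : IsTrilinear t)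
    (n : ℤ) (X Y Z : Vec E M) (x : M) : t X Y (n • Z) x = n * t X Y Z x := by
  rw [← Int.cast_smul_eq_zsmul ℝ, (ht.trd X Y).map_smul]; rfl

theorem IsTrilinear.fst_zsmul {t : Vec E M → Vec E M → Vec E M → Fn E M} (ht : IsTrilinear t)
    (n : ℤ) (X Y Z : Vec E M) (x : M) : t (n • X) Y Z x = n * t X Y Z x := by
  rw [← Int.cast_smul_eq_zsmul ℝ, (ht.fst Y Z).map_smul]; rfl

theorem isFluxLike_flux (H : Form3 E M) (G : GenMetric E M) (κ : ℤ) (x : M) :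
    IsFluxLike κ fun X Y Z => flux H G X Y Z x where
  trd X Y Z := (isTrilinear_flux H G).trd_zsmul κ X Y Z x
  swap_left X Y Z := by rw [flux_swap_left]; rfl
  swap_right X Y Z := by rw [flux_swap_right]; rfl

theorem isTrilinear_nijTensor (G : GenMetric E M) (A : EndSec E M) (ε : ℤˣ) :
    IsTrilinear (nijTensor G A ε) := by
  have h := IsSkewStructure.isLinearMap_tangentEnd G A ε
  have hg := G.isBilinear_metric
  refine ⟨fun Y Z => ⟨fun X X' => ?_, fun r X => ?_⟩, fun X Z => ⟨fun Y Y' => ?_, fun r Y => ?_⟩,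
    fun X Y => hg.snd _⟩
  · simp only [nijTensor, nijenhuis, h.map_add, bracket_add_left, (hg.fst _).map_add,
      (hg.fst _).map_sub]
    ring
  · simp only [nijTensor, nijenhuis, h.map_smul, h.map_add, bracket_real_smul_left,
      (hg.fst _).map_add, (hg.fst _).map_sub, (hg.fst _).map_smul, smul_add, smul_sub]
  · simp only [nijTensor, nijenhuis, h.map_add, bracket_add_right, (hg.fst _).map_add,
      (hg.fst _).map_sub]
    ring
  · simp only [nijTensor, nijenhuis, h.map_smul, h.map_add, bracket_real_smul_right,
      (hg.fst _).map_add, (hg.fst _).map_sub, (hg.fst _).map_smul, smul_add, smul_sub]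

namespace IsSkewStructure

variable {κ : ℤ} {G : GenMetric E M} {A : EndSec E M}

theorem isCovFundLike_covFund (h : IsSkewStructure κ G A) (ε : ℤˣ) (x : M) :
    IsCovFundLike (tangentEnd G A ε) κ fun X Y Z => covFund G A ε X Y Z x where
  fst X Y Z := (isTrilinear_covFund G A ε).fst_zsmul κ X Y Z x
  trd X Y Z := (isTrilinear_covFund G A ε).trd_zsmul κ X Y Z x
  swap X Y Z := by rw [h.covFund_swap]; rfl
  left X Y Z := by
    have k2 : koszul G X (κ • Y) Z x = κ * koszul G X Y Z x := by
      rw [← Int.cast_smul_eq_zsmul ℝ, ((isTrilinear_koszul G).snd X Z).map_smul]; rfl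
    have k3 := (isTrilinear_koszul G).trd_zsmul κ X Y Z x
    simp only [covFund, h.tangentEnd_tangentEnd]
    rw [ContMDiffMap.coe_add, ContMDiffMap.coe_add, Pi.add_apply, Pi.add_apply, k2, k3, add_comm]

theorem nijTensor_eq_apply (h : IsSkewStructure κ G A) (ε : ℤˣ) (X Y Z : Vec E M) (x : M) :
    nijTensor G A ε X Y Z x + nijTensor G A ε X Y Z x
      = covFund G A ε (tangentEnd G A ε X) Y Z x - covFund G A ε (tangentEnd G A ε Y) X Z x
        + covFund G A ε X Y (tangentEnd G A ε Z) x - covFund G A ε Y X (tangentEnd G A ε Z) x :=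
  congrArg (fun f : Fn E M => f x) (h.nijTensor_eq ε X Y Z)

theorem nijTensor_apply_apply_left (h : IsSkewStructure κ G A) (ε : ℤˣ) (X Y Z : Vec E M)
    (x : M) : nijTensor G A ε (tangentEnd G A ε X) (tangentEnd G A ε Y) Z x
      = κ * nijTensor G A ε X Y Z x := by
  have c := h.isCovFundLike_covFund ε x
  have n1 := h.nijTensor_eq_apply ε X Y Z x
  have n2 := h.nijTensor_eq_apply ε (tangentEnd G A ε X) (tangentEnd G A ε Y) Z x
  simp only [h.tangentEnd_tangentEnd, c.left, c.fst, c.trd] at n2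
  linear_combination (1 / 2 : ℝ) * n2 - (κ / 2 : ℝ) * n1

theorem nijTensor_apply_apply_right (h : IsSkewStructure κ G A) (ε : ℤˣ) (X Y Z : Vec E M)
    (x : M) : nijTensor G A ε (tangentEnd G A ε X) Y (tangentEnd G A ε Z) x
      = κ * nijTensor G A ε X Y Z x := by
  have c := h.isCovFundLike_covFund ε x
  have n1 := h.nijTensor_eq_apply ε X Y Z x
  have n2 := h.nijTensor_eq_apply ε (tangentEnd G A ε X) Y (tangentEnd G A ε Z) x
  have e : tangentEnd G A ε (κ • Z) = κ • tangentEnd G A ε Z := by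
    rw [← h.tangentEnd_tangentEnd, h.tangentEnd_tangentEnd]
  simp only [h.tangentEnd_tangentEnd, e, c.left, c.fst, c.trd] at n2
  linear_combination (1 / 2 : ℝ) * n2 - (κ / 2 : ℝ) * n1

theorem nijTensor_swap (G : GenMetric E M) (A : EndSec E M) (ε : ℤˣ) (X Y Z : Vec E M) (x : M) :
    nijTensor G A ε X Y Z x = -nijTensor G A ε Y X Z x := by
  have h : nijenhuis (tangentEnd G A ε) X Y = -nijenhuis (tangentEnd G A ε) Y X := by
    have l := isLinearMap_tangentEnd G A ε
    simp only [nijenhuis]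
    rw [bracket_swap X Y, bracket_swap (tangentEnd G A ε X) (tangentEnd G A ε Y),
      bracket_swap X (tangentEnd G A ε Y), bracket_swap (tangentEnd G A ε X) Y]
    simp only [l.map_neg, l.map_add]
    abel
  rw [nijTensor, h, (G.isBilinear_metric.fst Z).map_neg]; rfl

/-- Applying `A` to any two arguments of `N` multiplies it by `κ`. Thus `N` is of pure type `(3,0) +
(0,3)`, which lets the para-complex criterion pass between `N` and its two pure components. -/
theorem applyTwo_nijTensor (h : IsSkewStructure κ G A) (ε : ℤˣ) (X Y Z : Vec E M) (x : M) :
    applyTwo (tangentEnd G A ε) (nijTensor G A ε) X Y Z x = 3 * κ * nijTensor G A ε X Y Z x := by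
  rw [applyTwo, h.nijTensor_apply_apply_right, h.nijTensor_apply_apply_left, nijTensor_swap,
    h.nijTensor_apply_apply_right, nijTensor_swap G A ε Y X]
  ring

/-- Weak integrability in terms of real vector fields, simultaneously for almost generalized
Kähler and para-Kähler structures. -/
theorem weaklyIntegrable_iff_real (h : IsSkewStructure κ G A) (hκ : κ * κ = 1) (H : Form3 E M) :
    WeaklyIntegrable H G A ↔ ∀ (ε : ℤˣ) (x : M) (X Y Z : Vec E M),
      (applyOne (tangentEnd G A ε) (extD (fundForm G A ε)) X Y Z x
          + κ * extD (fundForm G A ε) (tangentEnd G A ε X) (tangentEnd G A ε Y)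
            (tangentEnd G A ε Z) x
        = -3 * ((ε : ℤ) : ℝ) * (κ * flux H G X Y Z x
          + applyTwo (tangentEnd G A ε) (flux H G) X Y Z x)) ∧
      (nijTensor G A ε X Y Z x
        = -((ε : ℤ) : ℝ) * (κ * flux H G X Y Z x
          + applyTwo (tangentEnd G A ε) (flux H G) X Y Z x)) ∧
      (3 * extD (fundForm G A ε) X Y Z x
          - κ * applyTwo (tangentEnd G A ε) (extD (fundForm G A ε)) X Y Z x
        = -((ε : ℤ) : ℝ) * (applyOne (tangentEnd G A ε) (flux H G) X Y Z x
          - 3 * κ * flux H G (tangentEnd G A ε X) (tangentEnd G A ε Y) (tangentEnd G A ε Z) x)) := by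
  rw [h.weaklyIntegrable_iff]
  refine forall_congr' fun ε => ?_
  have hε : ((ε : ℤ) : ℝ) * ((ε : ℤ) : ℝ) = 1 := by
    rcases Int.units_eq_one_or ε with rfl | rfl <;> simp
  have e : (∀ X Y Z : Vec E M, ((ε : ℤ) : Fn E M) * covFund G A ε X Y Z
        + flux H G X (tangentEnd G A ε Y) Z + flux H G X Y (tangentEnd G A ε Z) = 0)
      ↔ ∀ (x : M) (X Y Z : Vec E M), ((ε : ℤ) : ℝ) * covFund G A ε X Y Z x
        + flux H G X (tangentEnd G A ε Y) Z x + flux H G X Y (tangentEnd G A ε Z) x = 0 := by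
    constructor
    · intro h0 x X Y Z
      have := congrArg (fun f : Fn E M => f x) (h0 X Y Z)
      simpa [intCast_fn_apply] using this
    · intro h0 X Y Z
      ext x
      simpa [intCast_fn_apply] using h0 x X Y Z
  rw [e]
  refine forall_congr' fun x => ?_
  exact parallel_iff (h.isCovFundLike_covFund ε x) (isFluxLike_flux H G κ x) hε hκ
    (h.tangentEnd_tangentEnd ε)
    (w := fun X Y Z => extD (fundForm G A ε) X Y Z x) (n := fun X Y Z => nijTensor G A ε X Y Z x)
    (fun X Y Z => congrArg (fun f : Fn E M => f x) (h.extD_fundForm ε X Y Z))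
    (fun X Y Z => h.nijTensor_eq_apply ε X Y Z x)

end IsSkewStructure

theorem IsAlmostGK.weaklyIntegrable_iff {G : GenMetric E M} {A : EndSec E M}
    (h : IsAlmostGK G A) (H : Form3 E M) :
    WeaklyIntegrable H G A ↔
        ∀ (ε : ℤˣ) (X Y Z : Vec E M) (x : M),
          Complex.I * (complexType (tangentEnd G A ε) 3 (extD (fundForm G A ε)) X Y Z x
              - complexType (tangentEnd G A ε) 0 (extD (fundForm G A ε)) X Y Z x)
            = ((ε : ℤ) : ℂ) * 3 * (complexType (tangentEnd G A ε) 3 (flux H G) X Y Z x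
              + complexType (tangentEnd G A ε) 0 (flux H G) X Y Z x) ∧
          ((ε : ℤ) : ℂ) * 3 * (complexType (tangentEnd G A ε) 3 (flux H G) X Y Z x
              + complexType (tangentEnd G A ε) 0 (flux H G) X Y Z x)
            = 3 / 4 * ((nijTensor G A ε X Y Z x : ℝ) : ℂ) ∧
          complexType (tangentEnd G A ε) 2 (extD (fundForm G A ε)) X Y Z x
              + complexType (tangentEnd G A ε) 1 (extD (fundForm G A ε)) X Y Z x
            = -((ε : ℤ) : ℂ) * Complex.I * (complexType (tangentEnd G A ε) 2 (flux H G) X Y Z x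
              - complexType (tangentEnd G A ε) 1 (flux H G) X Y Z x) := by
  rw [h.isSkewStructure.weaklyIntegrable_iff_real (by norm_num)]
  refine forall_congr' fun ε => ?_
  refine Iff.trans ⟨fun h0 X Y Z x => h0 x X Y Z, fun h0 x X Y Z => h0 X Y Z x⟩
    (forall₄_congr fun X Y Z x => ?_)
  have I2 := Complex.I_sq
  rw [complexType_three, complexType_three, complexType_two, complexType_two, complexType_one,
    complexType_one, complexType_zero, complexType_zero]
  set I := tangentEnd G A ε
  set w := extD (fundForm G A ε)
  set t := flux H G
  set n := nijTensor G A ε X Y Z x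
  -- Each side of the three complex equations is real, because conjugate types are added or
  -- subtracted with a factor `i`. Each equation is therefore a multiple of one of the real
  -- equations with `κ = -1`.
  have c : ((ε : ℤ) : ℂ) * 3 * (((t X Y Z x - applyTwo I t X Y Z x : ℝ)
      - Complex.I * (applyOne I t X Y Z x - t (I X) (I Y) (I Z) x : ℝ)) / 8
      + ((t X Y Z x - applyTwo I t X Y Z x : ℝ)
      + Complex.I * (applyOne I t X Y Z x - t (I X) (I Y) (I Z) x : ℝ)) / 8)
      = (((ε : ℤ) * 3 * (t X Y Z x - applyTwo I t X Y Z x) / 4 : ℝ) : ℂ) := by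
    push_cast; ring
  have c1 : Complex.I * (((w X Y Z x - applyTwo I w X Y Z x : ℝ)
      - Complex.I * (applyOne I w X Y Z x - w (I X) (I Y) (I Z) x : ℝ)) / 8
      - ((w X Y Z x - applyTwo I w X Y Z x : ℝ)
      + Complex.I * (applyOne I w X Y Z x - w (I X) (I Y) (I Z) x : ℝ)) / 8)
      = (((applyOne I w X Y Z x - w (I X) (I Y) (I Z) x) / 4 : ℝ) : ℂ) := by
    push_cast
    linear_combination (-(applyOne I w X Y Z x - w (I X) (I Y) (I Z) x) / 4 : ℂ) * I2
  have c2 : (3 / 4 : ℂ) * (n : ℂ) = ((3 / 4 * n : ℝ) : ℂ) := by push_cast; ring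
  have c3 : ((3 * w X Y Z x + applyTwo I w X Y Z x : ℝ)
      - Complex.I * (applyOne I w X Y Z x + 3 * w (I X) (I Y) (I Z) x : ℝ)) / 8
      + ((3 * w X Y Z x + applyTwo I w X Y Z x : ℝ)
      + Complex.I * (applyOne I w X Y Z x + 3 * w (I X) (I Y) (I Z) x : ℝ)) / 8
      = (((3 * w X Y Z x + applyTwo I w X Y Z x) / 4 : ℝ) : ℂ) := by
    push_cast; ring
  have c4 : -((ε : ℤ) : ℂ) * Complex.I * (((3 * t X Y Z x + applyTwo I t X Y Z x : ℝ)
      - Complex.I * (applyOne I t X Y Z x + 3 * t (I X) (I Y) (I Z) x : ℝ)) / 8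
      - ((3 * t X Y Z x + applyTwo I t X Y Z x : ℝ)
      + Complex.I * (applyOne I t X Y Z x + 3 * t (I X) (I Y) (I Z) x : ℝ)) / 8)
      = ((-(ε : ℤ) * (applyOne I t X Y Z x + 3 * t (I X) (I Y) (I Z) x) / 4 : ℝ) : ℂ) := by
    push_cast
    linear_combination
      ((ε : ℤ) * (applyOne I t X Y Z x + 3 * t (I X) (I Y) (I Z) x) / 4 : ℂ) * I2
  rw [c, c1, c2, c3, c4, Complex.ofReal_inj, Complex.ofReal_inj, Complex.ofReal_inj]
  push_cast
  constructor <;> rintro ⟨h1, h2, h3⟩ <;> refine ⟨?_, ?_, ?_⟩ <;> linarith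

theorem IsAlmostGpK.weaklyIntegrable_iff {G : GenMetric E M} {A : EndSec E M}
    (h : IsAlmostGpK G A) (H : Form3 E M) :
    WeaklyIntegrable H G A ↔
        ∀ (ε : ℤˣ) (X Y Z : Vec E M),
          paraType (tangentEnd G A ε) 3 (extD (fundForm G A ε)) X Y Z
            = -(ε • (3 : ℝ) • paraType (tangentEnd G A ε) 3 (flux H G) X Y Z) ∧
          -(ε • (3 : ℝ) • paraType (tangentEnd G A ε) 3 (flux H G) X Y Z)
            = (3 / 4 : ℝ) • paraType (tangentEnd G A ε) 3 (nijTensor G A ε) X Y Z ∧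
          paraType (tangentEnd G A ε) 0 (extD (fundForm G A ε)) X Y Z
            = ε • (3 : ℝ) • paraType (tangentEnd G A ε) 0 (flux H G) X Y Z ∧
          ε • (3 : ℝ) • paraType (tangentEnd G A ε) 0 (flux H G) X Y Z
            = -((3 / 4 : ℝ) • paraType (tangentEnd G A ε) 0 (nijTensor G A ε) X Y Z) ∧
          paraType (tangentEnd G A ε) 2 (extD (fundForm G A ε)) X Y Z
            = -(ε • paraType (tangentEnd G A ε) 2 (flux H G) X Y Z) ∧
          paraType (tangentEnd G A ε) 1 (extD (fundForm G A ε)) X Y Z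
            = ε • paraType (tangentEnd G A ε) 1 (flux H G) X Y Z := by
  have hs := h.isSkewStructure
  rw [hs.weaklyIntegrable_iff_real (by norm_num)]
  refine forall_congr' fun ε => ?_
  have tw := isTrilinear_extD (isBilinear_fundForm G A ε)
  have th := isTrilinear_flux H G
  have tn := isTrilinear_nijTensor G A ε
  have hA := hs.tangentEnd_tangentEnd ε
  simp only [one_smul] at hA
  have sm : ∀ (f : Fn E M) (x : M), (ε • f : Fn E M) x = ((ε : ℤ) : ℝ) * f x := fun f x => by
    rw [Units.smul_def, ← Int.cast_smul_eq_zsmul ℝ]; rfl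
  have fe : ∀ f g : Fn E M, f = g ↔ ∀ x, f x = g x := fun f g =>
    ⟨fun e x => by rw [e], fun e => by ext x; exact e x⟩
  have ne : ∀ (f : Fn E M) (x : M), (-f) x = -f x := fun f x => rfl
  have rs : ∀ (r : ℝ) (f : Fn E M) (x : M), (r • f) x = r * f x := fun r f x => rfl
  simp only [fe, sm, ne, rs, paraType_three _ _ _ _ tw, paraType_three _ _ _ _ th,
    paraType_three _ _ _ _ tn, paraType_two _ _ _ _ tw, paraType_two _ _ _ _ th,
    paraType_one _ _ _ _ tw, paraType_one _ _ _ _ th, paraType_zero _ _ _ _ tw,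
    paraType_zero _ _ _ _ th, paraType_zero _ _ _ _ tn]
  constructor
  · intro h0 X Y Z
    -- Summing an equation over the insertions of `K` into one argument scales types `(3,0)`,
    -- `(2,1)`, `(1,2)`, `(0,3)` by `3, 1, -1, -3`. Comparison with the original equation separates
    -- opposite types.
    have k : ∀ x, _ := fun x => And.intro (h0 x X Y Z) <| And.intro (h0 x (tangentEnd G A ε X) Y Z)
      <| And.intro (h0 x X (tangentEnd G A ε Y) Z) (h0 x X Y (tangentEnd G A ε Z))
    refine ⟨fun x => ?_, fun x => ?_, fun x => ?_, fun x => ?_, fun x => ?_, fun x => ?_⟩ <;>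
    · obtain ⟨⟨a0, b0, c0⟩, ⟨a1, b1, c1⟩, ⟨a2, b2, c2⟩, ⟨a3, b3, c3⟩⟩ := k x
      have n0 := hs.applyTwo_nijTensor ε X Y Z x
      have n3 := hs.nijTensor_apply_apply_left ε X Y (tangentEnd G A ε Z) x
      simp only [applyOne, applyTwo, hA, Int.cast_one, one_mul, mul_one] at *
      rcases Int.units_eq_one_or ε with e | e <;>
        simp only [e, Units.val_one, Units.val_neg, Int.cast_one, Int.cast_neg] at * <;> linarith
  · intro h0 x X Y Z
    obtain ⟨p1, p2, p3, p4, p5, p6⟩ := h0 X Y Z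
    have p1 := p1 x
    have p2 := p2 x
    have p3 := p3 x
    have p4 := p4 x
    have p5 := p5 x
    have p6 := p6 x
    -- By purity the two components of `N` in the hypotheses add up to `N` itself.
    have n0 := hs.applyTwo_nijTensor ε X Y Z x
    refine ⟨?_, ?_, ?_⟩ <;> push_cast at * <;> linarith

end

end GenGeom

end

theorem mainTheorem6 {E : Type*} [NormedAddCommGroup E] [NormedSpace ℝ E] [FiniteDimensional ℝ E]
    {M : Type*} [TopologicalSpace M] [T2Space M] [SecondCountableTopology M] [ChartedSpace E M]
    [IsManifold 𝓘(ℝ, E) ∞ M] (H : Form3 E M) (G : GenMetric E M) :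
    (∀ A : EndSec E M, IsAlmostGK G A →
      (WeaklyIntegrable H G A ↔
        ∀ (ε : ℤˣ) (X Y Z : Vec E M) (x : M),
          Complex.I * (complexType (tangentEnd G A ε) 3 (extD (fundForm G A ε)) X Y Z x
              - complexType (tangentEnd G A ε) 0 (extD (fundForm G A ε)) X Y Z x)
            = ((ε : ℤ) : ℂ) * 3 * (complexType (tangentEnd G A ε) 3 (flux H G) X Y Z x
              + complexType (tangentEnd G A ε) 0 (flux H G) X Y Z x) ∧
          ((ε : ℤ) : ℂ) * 3 * (complexType (tangentEnd G A ε) 3 (flux H G) X Y Z x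
              + complexType (tangentEnd G A ε) 0 (flux H G) X Y Z x)
            = 3 / 4 * ((nijTensor G A ε X Y Z x : ℝ) : ℂ) ∧
          complexType (tangentEnd G A ε) 2 (extD (fundForm G A ε)) X Y Z x
              + complexType (tangentEnd G A ε) 1 (extD (fundForm G A ε)) X Y Z x
            = -((ε : ℤ) : ℂ) * Complex.I * (complexType (tangentEnd G A ε) 2 (flux H G) X Y Z x
              - complexType (tangentEnd G A ε) 1 (flux H G) X Y Z x))) ∧
    (∀ A : EndSec E M, IsAlmostGpK G A →
      (WeaklyIntegrable H G A ↔
        ∀ (ε : ℤˣ) (X Y Z : Vec E M),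
          paraType (tangentEnd G A ε) 3 (extD (fundForm G A ε)) X Y Z
            = -(ε • (3 : ℝ) • paraType (tangentEnd G A ε) 3 (flux H G) X Y Z) ∧
          -(ε • (3 : ℝ) • paraType (tangentEnd G A ε) 3 (flux H G) X Y Z)
            = (3 / 4 : ℝ) • paraType (tangentEnd G A ε) 3 (nijTensor G A ε) X Y Z ∧
          paraType (tangentEnd G A ε) 0 (extD (fundForm G A ε)) X Y Z
            = ε • (3 : ℝ) • paraType (tangentEnd G A ε) 0 (flux H G) X Y Z ∧
          ε • (3 : ℝ) • paraType (tangentEnd G A ε) 0 (flux H G) X Y Z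
            = -((3 / 4 : ℝ) • paraType (tangentEnd G A ε) 0 (nijTensor G A ε) X Y Z) ∧
          paraType (tangentEnd G A ε) 2 (extD (fundForm G A ε)) X Y Z
            = -(ε • paraType (tangentEnd G A ε) 2 (flux H G) X Y Z) ∧
          paraType (tangentEnd G A ε) 1 (extD (fundForm G A ε)) X Y Z
            = ε • paraType (tangentEnd G A ε) 1 (flux H G) X Y Z)) := 
  ⟨fun _ h => h.weaklyIntegrable_iff H, fun _ h => h.weaklyIntegrable_iff H⟩
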